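/- For $\lambda\in\mathbb R$ let $(x+i0)^\lambda=\lim_{\varepsilon\downarrow0}(x^2+\varepsilon^2)^{\lambda/2}e^{i\lambda\arg(x+i\varepsilon)}$ (limit in $\mathcal S'(\mathbb R)$). The space $H^s_{\rm loc}(\mathbb R)$ consists of the $f\in\mathcal S'(\mathbb R)$ with $\langle\xi\rangle^s\,\mathcal F(\psi f)\in L^2(\mathbb R)$ for all $\psi\in\mathcal D(\mathbb R)$. For tempered distributions $u,v$ the Fourier product is $u\cdot v=\mathcal F^{-1}(\mathcal Fu*\mathcal Fv)$, provided the $\mathcal S'$-convolution exists; here the $\mathcal S'$-convolution $S*T$ exists if $(\varphi*S^-)T\in\mathcal D'_{L^1}$ for all $\varphi\in\mathcal S$, where $S^-(x)=S(-x)$, and then $\langle S*T,\varphi\rangle=\langle(\varphi*S^-)T,1\rangle$. Powers $u^p$, $p\ge1$, are iterated Fourier products. (i) For every real $s<\tfrac12$ there are an integer $p\ge2$ and $\lambda=\tfrac{2}{1-p}<0$ such that the following hold. (a) The distribution $u_0=(x+i0)^\lambda$ exists, belongs to $H^s_{\rm loc}(\mathbb R)$, and has singular support $\{0\}$. (b)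 The stationary distribution $u(x,t)\equiv u_0(x)$ on $\mathbb R^2$ is a distributional solution of $$\partial_t^2u-\partial_x^2u=-\lambda(\lambda-1)\,u^p,\qquad u(x,0)=u_0(x),\quad \partial_tu(x,0)=0,$$ where the power $u^p$ exists as a Fourier product on $\mathbb R^2$. The singular support of $u$ is the line $\{(0,t):t\in\mathbb R\}$, which is noncharacteristic for $\partial_t^2-\partial_x^2$. (ii) For every integer $p\ge2$ and $\lambda=\tfrac{2}{1-p}<0$, the distribution $u_0=(x+i0)^\lambda$ exists, has singular support $\{0\}$, and belongs to $H^s_{\rm loc}(\mathbb R)$ for every $s<\tfrac12-\tfrac{2}{p-1}$. The stationary distribution $u(x,t)\equiv u_0(x)$ solves the problem in (b) in the same sense and has singular support $\{(0,t):t\in\mathbb R\}$. Moreover, for each choice of sign there is a constant $c\in\mathbb C\setminus\{0\}$ such that $v=cu$ is a distributional solution of $\partial_t^2v-\partial_x^2v=\pm v^p$, $v(x,0)=c\,u_0(x)$, $\partial_tv(x,0)=0$. -/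

import Mathlib

open scoped SchwartzMap LineDeriv FourierTransform ContDiff Topology
open MeasureTheory Filter

noncomputable section

namespace NLW

/-! ### Local Sobolev spaces, singular support -/

section General

variable {E : Type*} [NormedAddCommGroup E] [InnerProductSpace ℝ E] [FiniteDimensional ℝ E]
  [MeasurableSpace E] [BorelSpace E]

/-- `f ∈ H^s_loc(E)`: for every `ψ ∈ 𝓓(E)` the product `ψ f` lies in `H^s(E)`, that is,
`(1 + |ξ|²)^(s/2) 𝓕(ψ f) ∈ L²`. -/
def MemSobolevLoc (s : ℝ) (f : 𝓢'(E, ℂ)) : Prop :=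
  ∀ ψ : E → ℂ, ContDiff ℝ ∞ ψ → HasCompactSupport ψ →
    TemperedDistribution.MemSobolev s 2 (TemperedDistribution.smulLeftCLM ℂ ψ f)

/-- `f` coincides on the set `V` with a function that is smooth on `V`. -/
def IsSmoothOn (f : 𝓢'(E, ℂ)) (V : Set E) : Prop :=
  ∃ g : E → ℂ, ContDiffOn ℝ ∞ g V ∧
    ∀ φ : 𝓢(E, ℂ), HasCompactSupport φ → tsupport φ ⊆ V → f φ = ∫ x, φ x * g x

/-- The singular support: the complement of the largest open set on which `f` is smooth. -/
def singSupp (f : 𝓢'(E, ℂ)) : Set E :=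
  {x | ¬ ∃ V : Set E, IsOpen V ∧ x ∈ V ∧ IsSmoothOn f V}

/-! ### The `𝓢'`-convolution and the Fourier product -/

/-- `T ∈ 𝓓'_{L¹}`: `T` belongs to the dual of the space of smooth functions all of whose
derivatives vanish at infinity, with the seminorms `sup |∂^α φ|` (the Schwartz functions are dense
in that space). -/
def IsIntegrableDistribution (T : 𝓢'(E, ℂ)) : Prop :=
  ∃ (N : ℕ) (C : ℝ), ∀ φ : 𝓢(E, ℂ),
    ‖T φ‖ ≤ C * ∑ j ∈ Finset.range (N + 1), SchwartzMap.seminorm ℂ 0 j φ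

/-- A sequence of test functions which equals `1` eventually on every compact set, and all of
whose derivatives are bounded uniformly along the sequence. -/
structure IsApproximateUnit (χ : ℕ → 𝓢(E, ℂ)) : Prop where
  hasCompactSupport : ∀ n, HasCompactSupport (χ n)
  eventually_eq_one : ∀ K : Set E, IsCompact K → ∀ᶠ n in atTop, ∀ x ∈ K, χ n x = 1
  bounded : ∀ j : ℕ, ∃ C : ℝ, ∀ n, SchwartzMap.seminorm ℂ 0 j (χ n) ≤ C

/-- `T ∈ 𝓓'_{L¹}` and `⟨T, 1⟩ = c`. -/
def HasDistributionIntegral (T : 𝓢'(E, ℂ)) (c : ℂ) : Prop :=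
  IsIntegrableDistribution T ∧
    ∀ χ : ℕ → 𝓢(E, ℂ), IsApproximateUnit χ → Tendsto (fun n ↦ T (χ n)) atTop (𝓝 c)

/-- The function `φ ∗ S⁻`, where `S⁻(x) = S(-x)`:
`(φ ∗ S⁻)(y) = ⟨S⁻(z), φ(y - z)⟩ = ⟨S(w), φ(w + y)⟩`. It is smooth of temperate growth. -/
def convReflect (φ : 𝓢(E, ℂ)) (S : 𝓢'(E, ℂ)) : E → ℂ :=
  fun y ↦ S (SchwartzMap.compSubConstCLM ℂ (-y) φ)

/-- The `𝓢'`-convolution `S ∗ T` exists and equals `W`: for every Schwartz function `φ`,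
`(φ ∗ S⁻) T ∈ 𝓓'_{L¹}` and `⟨W, φ⟩ = ⟨(φ ∗ S⁻) T, 1⟩`. -/
def IsSConvolution (S T W : 𝓢'(E, ℂ)) : Prop :=
  ∀ φ : 𝓢(E, ℂ),
    HasDistributionIntegral (TemperedDistribution.smulLeftCLM ℂ (convReflect φ S) T) (W φ)

/-- The Fourier product `u · v = 𝓕⁻¹(𝓕 u ∗ 𝓕 v)` exists and equals `w`. -/
def IsFourierProduct (u v w : 𝓢'(E, ℂ)) : Prop :=
  IsSConvolution (𝓕 u) (𝓕 v) (𝓕 w)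

/-- `IsFourierPower u p w`: the power `u^p`, `p ≥ 1`, exists as an iterated Fourier product, and
equals `w`. -/
inductive IsFourierPower (u : 𝓢'(E, ℂ)) : ℕ → 𝓢'(E, ℂ) → Prop
  | one : IsFourierPower u 1 u
  | succ {n : ℕ} {v w : 𝓢'(E, ℂ)} :
      IsFourierPower u n v → IsFourierProduct u v w → IsFourierPower u (n + 1) w

end General

/-! ### The distribution `(x + i0)^lam` -/

/-- `u = (x + i0)^lam`, the limit in `𝓢'(ℝ)`, as `ε` decreases to `0`, of the functions
`(x + iε)^lam = (x² + ε²)^(lam/2) exp(i lam arg(x + iε))`. -/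
def IsXPlusIZeroPow (lam : ℝ) (u : 𝓢'(ℝ, ℂ)) : Prop :=
  ∀ φ : 𝓢(ℝ, ℂ),
    Tendsto (fun ε : ℝ ↦ ∫ x : ℝ, φ x * ((x : ℂ) + (ε : ℂ) * Complex.I) ^ (lam : ℂ))
      (𝓝[>] 0) (𝓝 (u φ))

/-! ### The wave equation in one space dimension -/

/-- The plane of points `(x, t)`: coordinate `0` is `x`, coordinate `1` is `t`. -/
abbrev Plane := EuclideanSpace ℝ (Fin 2)

theorem hasTemperateGrowth_slice (t : ℝ) :
    (fun x : ℝ ↦ (!₂[x, t] : Plane)).HasTemperateGrowth := by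
  have h : (fun x : ℝ ↦ (!₂[x, t] : Plane)) =
      fun x : ℝ ↦ (ContinuousLinearMap.toSpanSingleton ℝ (!₂[1, 0] : Plane)) x + !₂[0, t] := by
    funext x
    ext i
    fin_cases i <;> simp
  rw [h]
  exact (ContinuousLinearMap.hasTemperateGrowth _).add (Function.HasTemperateGrowth.const _)

theorem norm_le_slice (t : ℝ) :
    ∃ (k : ℕ) (C : ℝ), ∀ x : ℝ, ‖x‖ ≤ C * (1 + ‖(!₂[x, t] : Plane)‖) ^ k := by
  refine ⟨1, 1, fun x ↦ ?_⟩
  have h := PiLp.norm_apply_le (!₂[x, t] : Plane) 0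
  have h' : ‖x‖ ≤ ‖(!₂[x, t] : Plane)‖ := by simpa using h
  linarith

/-- The test function `x ↦ φ(x, t)`. -/
def slice (t : ℝ) (φ : 𝓢(Plane, ℂ)) : 𝓢(ℝ, ℂ) :=
  SchwartzMap.compCLM ℂ (hasTemperateGrowth_slice t) (norm_le_slice t) φ

/-- The distribution `U(x, t)` on the plane is given by the family `t ↦ g t` of distributions
in `x`: `⟨U, φ⟩ = ∫ ⟨g t, φ(·, t)⟩ dt` for all test functions `φ`. -/
def IsGivenByFamily (g : ℝ → 𝓢'(ℝ, ℂ)) (U : 𝓢'(Plane, ℂ)) : Prop :=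
  ∀ φ : 𝓢(Plane, ℂ), HasCompactSupport φ →
    Integrable (fun t : ℝ ↦ g t (slice t φ)) ∧ U φ = ∫ t : ℝ, g t (slice t φ)

/-- `U` is the stationary distribution `U(x, t) ≡ u₀(x)`. -/
def IsStationary (u₀ : 𝓢'(ℝ, ℂ)) (U : 𝓢'(Plane, ℂ)) : Prop :=
  IsGivenByFamily (fun _ ↦ u₀) U

/-- `U(x, 0) = u₀(x)` and `∂ₜU(x, 0) = u₁(x)`: `U` is given by a (weakly) continuously
differentiable curve of distributions in `x`, with value `u₀` and derivative `u₁` at `t = 0`. -/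
def HasInitialData (U : 𝓢'(Plane, ℂ)) (u₀ u₁ : 𝓢'(ℝ, ℂ)) : Prop :=
  ∃ g : ℝ → 𝓢'(ℝ, ℂ), IsGivenByFamily g U ∧
    (∀ φ : 𝓢(ℝ, ℂ), ContDiff ℝ 1 fun t ↦ g t φ) ∧
    g 0 = u₀ ∧ ∀ φ : 𝓢(ℝ, ℂ), HasDerivAt (fun t ↦ g t φ) (u₁ φ) 0

/-- `U` solves `∂ₜ²U - ∂ₓ²U = a U^p`, `U(x, 0) = u₀(x)`, `∂ₜU(x, 0) = u₁(x)` in the sense of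
distributions, with `U^p` a Fourier product on the plane. -/
def IsDistributionalSolution (a : ℂ) (p : ℕ) (u₀ u₁ : 𝓢'(ℝ, ℂ)) (U : 𝓢'(Plane, ℂ)) : Prop :=
  (∃ W : 𝓢'(Plane, ℂ), IsFourierPower U p W ∧
    ∂_{(!₂[0, 1] : Plane)} (∂_{(!₂[0, 1] : Plane)} U) -
      ∂_{(!₂[1, 0] : Plane)} (∂_{(!₂[1, 0] : Plane)} U) = a • W) ∧
  HasInitialData U u₀ u₁

/-- The line `{(0, t) : t ∈ ℝ}`. -/
def timeAxis : Set Plane := {q | q 0 = 0}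

/-- Nowhere characteristic for `∂ₜ² - ∂ₓ²`: every nonzero vector `(ξ, τ)` orthogonal to the line
`L` through the origin satisfies `τ² - ξ² ≠ 0`. -/
def IsNoncharacteristic (L : Set Plane) : Prop :=
  ∀ n : Plane, n ≠ 0 → (∀ q ∈ L, inner ℝ n q = 0) → n 1 ^ 2 - n 0 ^ 2 ≠ 0

end NLW

end

noncomputable section

namespace NLW

/-! ### The Riesz measures `ξ₊^(a-1) / Γ(a)` -/

section RieszMeasure

/-! Everything is read off on the Fourier side. Put `a = -lam = 2 / (p - 1)`. For `ε > 0` the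
Laplace integral of `ξ₊^(a-1) / Γ(a)` writes `(x + iε)^(-a)` as `(2π/i)^a` times an inverse Fourier
integral damped by `exp(-2πεξ)`. Letting `ε` tend to `0` under the `ξ`-integral shows that `(x +
i0)^(-a)` has Fourier transform `(2π/i)^a R_a`, with `R_a` the positive Riesz measure on the
half-line (`isXPlusIZeroPow_xPlusIZeroNegPow`).

Euler's Beta integral gives `R_a ∗ R_b = R_(a+b)` (`rieszMeasure_conv`). For positive measures of
temperate growth whose convolution is again one, the `𝓢'`-convolution is the convolution of
measures, by Fubini (`isSConvolution_toTemperedDistribution`). So Fourier products add exponents.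
The stationary extension to the plane has the pushforward of `R_a` to the `ξ`-axis as its transform,
and the same law holds there.

Since `p * a = a + 2`, the power `u^p` is `(x + i0)^(-a-2)`; multiplying `R_a` by `ξ²` gives `a(a+1)
R_(a+2)`, so `∂ₓ²u` is `a(a+1) u^p`, while `∂ₜ²u = 0`. An amplitude `c` with `k c^(p-1) = -a(a+1)`
produces any other nonzero coefficient `k`.

Off the singularity `u` is the function `x^(-a)`, smooth and unbounded at `x = 0`, which fixes the
singular support (`singSupp_eq_compl`). The transform of `ψ u₀` is a Schwartz function convolved
with a multiple of `R_a`, hence `O(⟨ξ⟩^(a-1))`, and this is square integrable against `⟨ξ⟩^s` when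
`s < 1/2 - a`. -/

/-- The density `x₊^(a-1) / Γ(a)`. -/
def rieszDensity (a x : ℝ) : ℝ :=
  if 0 < x then x ^ (a - 1) / Real.Gamma a else 0

/-- The measure with density `x₊^(a-1) / Γ(a)`. -/
def rieszMeasure (a : ℝ) : Measure ℝ :=
  volume.withDensity fun x ↦ ENNReal.ofReal (rieszDensity a x)

@[fun_prop]
theorem measurable_rieszDensity (a : ℝ) : Measurable (rieszDensity a) :=
  Measurable.ite measurableSet_Ioi (by fun_prop) measurable_const

theorem rieszDensity_of_pos {x : ℝ} (a : ℝ) (hx : 0 < x) :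
    rieszDensity a x = x ^ (a - 1) / Real.Gamma a := if_pos hx

theorem rieszDensity_of_nonpos {x : ℝ} (a : ℝ) (hx : x ≤ 0) : rieszDensity a x = 0 :=
  if_neg hx.not_gt

theorem rieszDensity_nonneg {a : ℝ} (ha : 0 < a) (x : ℝ) : 0 ≤ rieszDensity a x := by
  rcases le_or_gt x 0 with hx | hx
  · rw [rieszDensity_of_nonpos a hx]
  · rw [rieszDensity_of_pos a hx]
    have := Real.Gamma_pos_of_pos ha
    positivity

instance (a : ℝ) : SFinite (rieszMeasure a) := by
  unfold rieszMeasure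
  infer_instance

theorem integrable_rieszMeasure_iff {F : Type*} [NormedAddCommGroup F] [NormedSpace ℝ F]
    {a : ℝ} (ha : 0 < a) {f : ℝ → F} :
    Integrable f (rieszMeasure a) ↔ IntegrableOn (fun x ↦ x ^ (a - 1) • f x) (Set.Ioi 0) := by
  have h0 := (Real.Gamma_pos_of_pos ha).ne'
  rw [rieszMeasure, integrable_withDensity_iff_integrable_smul' (by fun_prop) (by simp),
    ← integrable_indicator_iff measurableSet_Ioi]
  have : (fun x ↦ (ENNReal.ofReal (rieszDensity a x)).toReal • f x) =
      fun x ↦ (Real.Gamma a)⁻¹ • (Set.Ioi 0).indicator (fun x ↦ x ^ (a - 1) • f x) x := by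
    funext x
    rw [ENNReal.toReal_ofReal (rieszDensity_nonneg ha x)]
    rcases le_or_gt x 0 with hx | hx
    · simp [rieszDensity_of_nonpos a hx, hx]
    · simp [rieszDensity_of_pos a hx, hx, smul_smul, div_eq_inv_mul]
  rw [this]
  exact integrable_fun_smul_iff (inv_ne_zero h0) _

theorem integral_rieszMeasure {F : Type*} [NormedAddCommGroup F] [NormedSpace ℝ F]
    {a : ℝ} (ha : 0 < a) (f : ℝ → F) :
    ∫ x, f x ∂(rieszMeasure a) = (Real.Gamma a)⁻¹ • ∫ x in Set.Ioi 0, x ^ (a - 1) • f x := by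
  rw [rieszMeasure, integral_withDensity_eq_integral_toReal_smul (by fun_prop) (by simp),
    ← integral_indicator measurableSet_Ioi, ← integral_smul]
  congr 1 with x
  rw [ENNReal.toReal_ofReal (rieszDensity_nonneg ha x)]
  rcases le_or_gt x 0 with hx | hx
  · simp [rieszDensity_of_nonpos a hx, hx]
  · simp [rieszDensity_of_pos a hx, hx, smul_smul, div_eq_inv_mul]

theorem ae_rieszMeasure_pos (a : ℝ) : ∀ᵐ x ∂(rieszMeasure a), 0 < x := by
  rw [rieszMeasure, ae_withDensity_iff (by fun_prop)]
  refine ae_of_all _ fun x hx ↦ ?_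
  by_contra h
  simp [rieszDensity_of_nonpos a (not_lt.1 h)] at hx

/-- Positivity of `a` makes the density integrable at `0`; any integer power above `a` beats its
growth at infinity. -/
theorem hasTemperateGrowth_rieszMeasure {a : ℝ} (ha : 0 < a) :
    (rieszMeasure a).HasTemperateGrowth := by
  obtain ⟨n, hn⟩ := exists_nat_gt a
  refine ⟨n, ?_⟩
  rw [integrable_rieszMeasure_iff ha, ← Set.Ioc_union_Ioi_eq_Ioi zero_le_one]
  have hm : Measurable fun x : ℝ ↦ x ^ (a - 1) • (1 + ‖x‖) ^ (-(n : ℝ)) := by fun_prop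
  refine IntegrableOn.union ?_ ?_
  · have h1 : IntegrableOn (fun x : ℝ ↦ x ^ (a - 1)) (Set.Ioc 0 1) := by
      rw [← intervalIntegrable_iff_integrableOn_Ioc_of_le zero_le_one]
      exact intervalIntegral.intervalIntegrable_rpow' (by linarith)
    refine h1.mono' hm.aestronglyMeasurable ?_
    filter_upwards [ae_restrict_mem measurableSet_Ioc] with x hx
    have hx0 : 0 < x := hx.1
    rw [smul_eq_mul, norm_mul, Real.norm_of_nonneg (by positivity),
      Real.norm_of_nonneg (by positivity)]
    refine mul_le_of_le_one_right (by positivity) ?_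
    exact Real.rpow_le_one_of_one_le_of_nonpos (by simp) (by simp)
  · have h1 : IntegrableOn (fun x : ℝ ↦ x ^ (a - 1 - n)) (Set.Ioi 1) :=
      integrableOn_Ioi_rpow_of_lt (by linarith) one_pos
    refine h1.mono' hm.aestronglyMeasurable ?_
    filter_upwards [ae_restrict_mem measurableSet_Ioi] with x hx
    have hx0 : 0 < x := one_pos.trans hx
    rw [smul_eq_mul, norm_mul, Real.norm_of_nonneg (by positivity),
      Real.norm_of_nonneg (by positivity), sub_eq_add_neg (a - 1), Real.rpow_add hx0]
    gcongr ?_ * ?_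
    refine Real.rpow_le_rpow_of_nonpos hx0 ?_ (by simp)
    rw [Real.norm_of_nonneg hx0.le]
    linarith

theorem lintegral_Ioo_rpow_mul_rpow {a b x : ℝ} (ha : 0 < a) (hb : 0 < b) (hx : 0 < x) :
    ∫⁻ y in Set.Ioo 0 x, ENNReal.ofReal (y ^ (a - 1) * (x - y) ^ (b - 1)) =
      ENNReal.ofReal (x ^ (a + b - 1) * (Real.Gamma a * Real.Gamma b / Real.Gamma (a + b))) := by
  have hc := Complex.betaIntegral_scaled a b hx
  have hβ : Complex.betaIntegral a b =
      ((Real.Gamma a * Real.Gamma b / Real.Gamma (a + b) : ℝ) : ℂ) := by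
    rw [Complex.betaIntegral_eq_Gamma_mul_div _ _ (by simpa) (by simpa)]
    push_cast
    simp [← Complex.Gamma_ofReal]
  have hcongr : ∀ y ∈ Set.Ioo 0 x, (y : ℂ) ^ ((a : ℂ) - 1) * ((x : ℂ) - y) ^ ((b : ℂ) - 1) =
      ((y ^ (a - 1) * (x - y) ^ (b - 1) : ℝ) : ℂ) := by
    intro y hy
    push_cast
    rw [Complex.ofReal_cpow hy.1.le, Complex.ofReal_cpow (sub_nonneg.2 hy.2.le)]
    push_cast
    rfl
  have hI : ∫ y in Set.Ioo 0 x, (y ^ (a - 1) * (x - y) ^ (b - 1)) =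
      x ^ (a + b - 1) * (Real.Gamma a * Real.Gamma b / Real.Gamma (a + b)) := by
    rw [intervalIntegral.integral_of_le hx.le, integral_Ioc_eq_integral_Ioo,
      setIntegral_congr_fun measurableSet_Ioo hcongr, integral_complex_ofReal, hβ] at hc
    have h2 : (x : ℂ) ^ ((a : ℂ) + b - 1) = ((x ^ (a + b - 1) : ℝ) : ℂ) := by
      rw [Complex.ofReal_cpow hx.le]
      push_cast
      rfl
    rw [h2, ← Complex.ofReal_mul] at hc
    exact_mod_cast hc
  have hpos : 0 < x ^ (a + b - 1) * (Real.Gamma a * Real.Gamma b / Real.Gamma (a + b)) := by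
    have := Real.Gamma_pos_of_pos ha
    have := Real.Gamma_pos_of_pos hb
    have := Real.Gamma_pos_of_pos (add_pos ha hb)
    positivity
  rw [← hI, ofReal_integral_eq_lintegral_ofReal]
  -- Integrability comes from the value itself: a non-integrable function would have integral `0`,
  -- but the Beta value is positive.
  · by_contra h
    rw [integral_undef h] at hI
    exact hpos.ne hI
  · filter_upwards [ae_restrict_mem measurableSet_Ioo] with y hy
    have h1 := hy.1
    have h2 := sub_pos.2 hy.2
    show 0 ≤ y ^ (a - 1) * (x - y) ^ (b - 1)
    positivity

/-- The convolution at `x > 0` is a Beta integral over `(0, x)`, and the Gamma normalisations cancel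
its value exactly. -/
theorem rieszMeasure_conv {a b : ℝ} (ha : 0 < a) (hb : 0 < b) :
    (rieszMeasure a).conv (rieszMeasure b) = rieszMeasure (a + b) := by
  have hGa := Real.Gamma_pos_of_pos ha
  have hGb := Real.Gamma_pos_of_pos hb
  have hGab := Real.Gamma_pos_of_pos (add_pos ha hb)
  unfold rieszMeasure
  rw [conv_withDensity_eq_lconvolution (by fun_prop) (by fun_prop)]
  congr 1 with x
  rw [lconvolution_def]
  have hpt : ∀ y, ENNReal.ofReal (rieszDensity a y) * ENNReal.ofReal (rieszDensity b (-y + x)) =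
      (Set.Ioo 0 x).indicator (fun y ↦ ENNReal.ofReal (Real.Gamma a * Real.Gamma b)⁻¹ *
        ENNReal.ofReal (y ^ (a - 1) * (x - y) ^ (b - 1))) y := by
    intro y
    rw [neg_add_eq_sub]
    by_cases hy : y ∈ Set.Ioo 0 x
    · rw [Set.indicator_of_mem hy, rieszDensity_of_pos a hy.1,
        rieszDensity_of_pos b (sub_pos.2 hy.2), ← ENNReal.ofReal_mul (by have := hy.1; positivity),
        ← ENNReal.ofReal_mul (by positivity)]
      congr 1
      field_simp
    · rw [Set.indicator_of_notMem hy]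
      rcases le_or_gt y 0 with h | h
      · simp [rieszDensity_of_nonpos a h]
      · have : x - y ≤ 0 := by
          by_contra h'
          exact hy ⟨h, by linarith⟩
        simp [rieszDensity_of_nonpos b this]
  simp_rw [hpt]
  rw [lintegral_indicator measurableSet_Ioo, lintegral_const_mul' _ _ (by simp)]
  rcases le_or_gt x 0 with hx | hx
  · simp [Set.Ioo_eq_empty_of_le hx, rieszDensity_of_nonpos _ hx]
  · rw [lintegral_Ioo_rpow_mul_rpow ha hb hx, rieszDensity_of_pos _ hx,
      ← ENNReal.ofReal_mul (by positivity)]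
    congr 1
    field_simp

/-- This is `Γ(a+2) = (a+1) a Γ(a)`; it is the Fourier side of differentiating twice in `x`. -/
theorem integral_sq_smul_rieszMeasure {F : Type*} [NormedAddCommGroup F] [NormedSpace ℝ F]
    {a : ℝ} (ha : 0 < a) (f : ℝ → F) :
    ∫ x, x ^ 2 • f x ∂(rieszMeasure a) = (a * (a + 1)) • ∫ x, f x ∂(rieszMeasure (a + 2)) := by
  have hG : Real.Gamma (a + 2) = (a + 1) * (a * Real.Gamma a) := by
    rw [show a + 2 = (a + 1) + 1 by ring, Real.Gamma_add_one (by positivity),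
      Real.Gamma_add_one (by positivity)]
  have hGa := Real.Gamma_pos_of_pos ha
  rw [integral_rieszMeasure ha, integral_rieszMeasure (by positivity), smul_smul, hG]
  congr 1
  · field_simp
  · refine setIntegral_congr_fun measurableSet_Ioi fun x (hx : 0 < x) ↦ ?_
    simp only [smul_smul]
    congr 1
    rw [show a + 2 - 1 = (a - 1) + (2 : ℕ) by push_cast; ring, Real.rpow_add_natCast hx.ne']

theorem integrable_exp_rieszMeasure {a r : ℝ} (ha : 0 < a) (hr : r < 0) :
    Integrable (fun x ↦ Real.exp (r * x)) (rieszMeasure a) := by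
  rw [integrable_rieszMeasure_iff ha]
  have := integrableOn_rpow_mul_exp_neg_mul_rpow (s := a - 1) (p := 1) (b := -r)
    (by linarith) one_pos (by linarith)
  simpa using this

/-- For real `z` this is the Gamma integral. Both sides are analytic in the half-plane, so the
identity theorem extends it. -/
theorem integral_cexp_rieszMeasure {a : ℝ} (ha : 0 < a) {z : ℂ} (hz : 0 < z.re) :
    ∫ x, Complex.exp (-z * x) ∂(rieszMeasure a) = z ^ (-(a : ℂ)) := by
  have hset : {w : ℂ | w.re < 0} ⊆
      {w : ℂ | w.re ∈ interior (ProbabilityTheory.integrableExpSet id (rieszMeasure a))} := by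
    intro w hw
    have : Set.Iio (0 : ℝ) ⊆ ProbabilityTheory.integrableExpSet id (rieszMeasure a) :=
      fun r hr ↦ integrable_exp_rieszMeasure ha hr
    exact interior_maximal this isOpen_Iio hw
  have hopen : IsOpen {w : ℂ | w.re < 0} := isOpen_lt Complex.continuous_re continuous_const
  have hF : AnalyticOnNhd ℂ (ProbabilityTheory.complexMGF id (rieszMeasure a))
      {w : ℂ | w.re < 0} :=
    DifferentiableOn.analyticOnNhd (ProbabilityTheory.differentiableOn_complexMGF.mono hset) hopen
  have hG : AnalyticOnNhd ℂ (fun w : ℂ ↦ (-w) ^ (-(a : ℂ))) {w : ℂ | w.re < 0} := by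
    refine DifferentiableOn.analyticOnNhd (fun w hw ↦ ?_) hopen
    refine (DifferentiableAt.cpow (by fun_prop) (by fun_prop) ?_).differentiableWithinAt
    left
    simpa using hw
  have hreal : ∀ r : ℝ, r < 0 → ProbabilityTheory.complexMGF id (rieszMeasure a) r =
      (-(r : ℂ)) ^ (-(a : ℂ)) := by
    intro r hr
    have h1 := Real.integral_rpow_mul_exp_neg_mul_Ioi ha (neg_pos.2 hr)
    have hGa := Real.Gamma_pos_of_pos ha
    rw [ProbabilityTheory.complexMGF_ofReal, ProbabilityTheory.mgf, integral_rieszMeasure ha,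
      ← Complex.ofReal_neg r, ← Complex.ofReal_neg a, ← Complex.ofReal_cpow (by linarith)]
    congr 1
    simp only [id, smul_eq_mul]
    simp only [neg_mul, neg_neg] at h1
    rw [h1, Real.rpow_neg (by linarith), Real.div_rpow (by simp) (by linarith)]
    field_simp
    simp
  have key := hF.eqOn_of_preconnected_of_frequently_eq hG
    (convex_halfSpace_re_lt 0).isPreconnected (z₀ := -1) (by simp) ?_
  · have := key (show -z ∈ {w : ℂ | w.re < 0} by simpa using hz)
    simpa [ProbabilityTheory.complexMGF] using this
  -- Negative real points accumulating at `-1` suffice for the identity theorem.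
  · have hT : Tendsto (fun n : ℕ ↦ ((-1 - 1 / ((n : ℝ) + 1) : ℝ) : ℂ)) atTop (𝓝[≠] (-1)) := by
      refine tendsto_nhdsWithin_iff.2 ⟨?_, ?_⟩
      · have h1 : Tendsto (fun n : ℕ ↦ (-1 - 1 / ((n : ℝ) + 1) : ℝ)) atTop (𝓝 (-1)) := by
          simpa using tendsto_one_div_add_atTop_nhds_zero_nat.const_sub (-1 : ℝ)
        have := (Complex.continuous_ofReal.tendsto (-1)).comp h1
        rw [show (-1 : ℂ) = ((-1 : ℝ) : ℂ) by simp]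
        exact this
      · refine Eventually.of_forall fun n ↦ ?_
        have : (0 : ℝ) < 1 / ((n : ℝ) + 1) := by positivity
        intro h
        have h' : (-1 - 1 / ((n : ℝ) + 1) : ℝ) = -1 :=
          Complex.ofReal_injective (h.trans (by simp))
        linarith
    refine hT.frequently (Frequently.of_forall fun n ↦ ?_)
    have : (0 : ℝ) < 1 / ((n : ℝ) + 1) := by positivity
    exact hreal _ (by linarith)

end RieszMeasure

/-! ### Convolution of measures as `𝓢'`-convolution -/

section MeasureConvolution

theorem exists_norm_le_one_add_norm_rpow {E F : Type*} [NormedAddCommGroup E] [NormedSpace ℝ E]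
    [NormedAddCommGroup F] [NormedSpace ℝ F] (φ : 𝓢(E, F)) (k : ℕ) :
    ∃ C : ℝ, 0 ≤ C ∧ ∀ x, ‖φ x‖ ≤ C * (1 + ‖x‖) ^ (-(k : ℝ)) := by
  refine ⟨2 ^ k * ((Finset.Iic (k, 0)).sup fun m => SchwartzMap.seminorm ℝ m.1 m.2) φ,
    mul_nonneg (by positivity) (apply_nonneg _ _), fun x ↦ ?_⟩
  have h := SchwartzMap.one_add_le_sup_seminorm_apply (𝕜 := ℝ) (m := (k, 0)) le_rfl le_rfl φ x
  rw [norm_iteratedFDeriv_zero] at h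
  rw [Real.rpow_neg (by positivity), ← div_eq_mul_inv, le_div_iff₀ (by positivity),
    Real.rpow_natCast, mul_comm]
  exact h

theorem one_add_norm_add_rpow_le {E : Type*} [NormedAddCommGroup E] (w y : E) {R : ℝ}
    (hR : ‖y‖ ≤ R) (k : ℕ) :
    (1 + ‖w + y‖) ^ (-(k : ℝ)) ≤ (1 + R) ^ k * (1 + ‖w‖) ^ (-(k : ℝ)) := by
  rw [Real.rpow_neg (by positivity), Real.rpow_neg (by positivity), Real.rpow_natCast,
    Real.rpow_natCast, ← div_eq_mul_inv, le_div_iff₀ (by positivity), ← div_eq_inv_mul,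
    div_le_iff₀ (by positivity), ← mul_pow]
  have h1 : ‖w‖ ≤ ‖w + y‖ + ‖y‖ := by simpa using norm_sub_le (w + y) y
  have h0 : 0 ≤ R := (norm_nonneg y).trans hR
  gcongr
  nlinarith [norm_nonneg (w + y)]

theorem integrable_shift {E F : Type*} [NormedAddCommGroup E] [NormedSpace ℝ E]
    [MeasurableSpace E] [BorelSpace E] [SecondCountableTopology E]
    [NormedAddCommGroup F] [NormedSpace ℝ F] (μ : Measure E) [μ.HasTemperateGrowth]
    (φ : 𝓢(E, F)) (y : E) : Integrable (fun w ↦ φ (w + y)) μ := by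
  refine ((SchwartzMap.compSubConstCLM ℝ (-y) φ).integrable (μ := μ)).congr (ae_of_all _ fun w ↦ ?_)
  simp

theorem exists_norm_integral_shift_le {E F : Type*} [NormedAddCommGroup E] [NormedSpace ℝ E]
    [MeasurableSpace E] [NormedAddCommGroup F] [NormedSpace ℝ F]
    (μ : Measure E) [μ.HasTemperateGrowth] (φ : 𝓢(E, F)) :
    ∃ (k : ℕ) (C : ℝ), ∀ y, ‖∫ w, φ (w + y) ∂μ‖ ≤ C * (1 + ‖y‖) ^ k := by
  obtain ⟨C, hC, h⟩ := exists_norm_le_one_add_norm_rpow φ μ.integrablePower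
  refine ⟨μ.integrablePower, C * ∫ w, (1 + ‖w‖) ^ (-(μ.integrablePower : ℝ)) ∂μ, fun y ↦ ?_⟩
  have hi := μ.integrable_pow_neg_integrablePower
  calc ‖∫ w, φ (w + y) ∂μ‖
      ≤ ∫ w, C * ((1 + ‖y‖) ^ μ.integrablePower * (1 + ‖w‖) ^ (-(μ.integrablePower : ℝ))) ∂μ := by
        refine norm_integral_le_of_norm_le ((hi.const_mul _).const_mul _) (ae_of_all _ fun w ↦ ?_)
        refine (h (w + y)).trans ?_
        gcongr
        exact one_add_norm_add_rpow_le w y le_rfl _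
    _ = _ := by
        rw [integral_const_mul, integral_const_mul]
        ring

theorem hasFDerivAt_integral_shift {E F : Type*} [NormedAddCommGroup E] [NormedSpace ℝ E]
    [MeasurableSpace E] [BorelSpace E] [SecondCountableTopology E]
    [NormedAddCommGroup F] [NormedSpace ℝ F] (μ : Measure E) [μ.HasTemperateGrowth]
    (φ : 𝓢(E, F)) (y : E) :
    HasFDerivAt (fun y ↦ ∫ w, φ (w + y) ∂μ)
      (∫ w, SchwartzMap.fderivCLM ℝ E F φ (w + y) ∂μ) y := by
  obtain ⟨C, hC, h⟩ :=
    exists_norm_le_one_add_norm_rpow (SchwartzMap.fderivCLM ℝ E F φ) μ.integrablePower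
  have hi := μ.integrable_pow_neg_integrablePower
  refine hasFDerivAt_integral_of_dominated_of_fderiv_le
    (F' := fun y w ↦ SchwartzMap.fderivCLM ℝ E F φ (w + y))
    -- The bound has to hold on the unit ball around `y`, where norms are at most `‖y‖ + 1`.
    (bound := fun w ↦ C * ((1 + (‖y‖ + 1)) ^ μ.integrablePower *
      (1 + ‖w‖) ^ (-(μ.integrablePower : ℝ))))
    (Metric.ball_mem_nhds y one_pos)
    (Eventually.of_forall fun z ↦ (integrable_shift μ φ z).aestronglyMeasurable)
    (integrable_shift μ φ y) (integrable_shift μ _ y).aestronglyMeasurable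
    (ae_of_all _ fun w z hz ↦ ?_) ((hi.const_mul _).const_mul _)
    (ae_of_all _ fun w z _ ↦ ?_)
  · refine (h (w + z)).trans ?_
    gcongr
    refine one_add_norm_add_rpow_le w z ?_ _
    have h1 : ‖z‖ ≤ ‖z - y‖ + ‖y‖ := by simpa using norm_add_le (z - y) y
    have h2 : ‖z - y‖ < 1 := by simpa [dist_eq_norm] using hz
    linarith
  · rw [SchwartzMap.fderivCLM_apply]
    exact (hasFDerivAt_comp_add_left w).2 (φ.hasFDerivAt (w + z))

/-- The derivative is the same kind of integral for a Schwartz function with values in `E →L[ℝ] F`.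
The induction therefore runs over all targets `F`, in a universe closed under this step. -/
theorem contDiff_integral_shift {E : Type} [NormedAddCommGroup E] [NormedSpace ℝ E]
    [MeasurableSpace E] [BorelSpace E] [SecondCountableTopology E]
    (μ : Measure E) [μ.HasTemperateGrowth] (n : ℕ) :
    ∀ {F : Type} [NormedAddCommGroup F] [NormedSpace ℝ F] (φ : 𝓢(E, F)),
      ContDiff ℝ n (fun y ↦ ∫ w, φ (w + y) ∂μ) ∧
      ∃ (k : ℕ) (C : ℝ), ∀ y,
        ‖iteratedFDeriv ℝ n (fun y ↦ ∫ w, φ (w + y) ∂μ) y‖ ≤ C * (1 + ‖y‖) ^ k := by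
  induction n with
  | zero =>
    intro F _ _ φ
    refine ⟨contDiff_zero.2 (continuous_iff_continuousAt.2 fun y ↦
      (hasFDerivAt_integral_shift μ φ y).continuousAt), ?_⟩
    simpa using exists_norm_integral_shift_le μ φ
  | succ n ih =>
    intro F _ _ φ
    obtain ⟨h1, k, C, h2⟩ := ih (SchwartzMap.fderivCLM ℝ E F φ)
    have hf : fderiv ℝ (fun y ↦ ∫ w, φ (w + y) ∂μ) =
        fun y ↦ ∫ w, SchwartzMap.fderivCLM ℝ E F φ (w + y) ∂μ :=
      funext fun y ↦ (hasFDerivAt_integral_shift μ φ y).fderiv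
    refine ⟨?_, k, C, fun y ↦ ?_⟩
    · rw [Nat.cast_add, Nat.cast_one]
      refine contDiff_succ_iff_fderiv.2
        ⟨fun y ↦ (hasFDerivAt_integral_shift μ φ y).differentiableAt, by simp, ?_⟩
      rw [hf]
      exact h1
    · rw [← norm_iteratedFDeriv_fderiv, hf]
      exact h2 y

theorem hasTemperateGrowth_integral_shift {E : Type} [NormedAddCommGroup E] [NormedSpace ℝ E]
    [MeasurableSpace E] [BorelSpace E] [SecondCountableTopology E]
    (μ : Measure E) [μ.HasTemperateGrowth] {F : Type} [NormedAddCommGroup F] [NormedSpace ℝ F]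
    (φ : 𝓢(E, F)) :
    (fun y ↦ ∫ w, φ (w + y) ∂μ).HasTemperateGrowth :=
  ⟨contDiff_infty.2 fun n ↦ (contDiff_integral_shift μ n φ).1,
    fun n ↦ (contDiff_integral_shift μ n φ).2⟩

theorem IsIntegrableDistribution.smul {E : Type*} [NormedAddCommGroup E]
    [InnerProductSpace ℝ E] {T : 𝓢'(E, ℂ)} (h : IsIntegrableDistribution T)
    (k : ℂ) :
    IsIntegrableDistribution (k • T) := by
  obtain ⟨N, C, h⟩ := h
  refine ⟨N, ‖k‖ * C, fun φ ↦ ?_⟩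
  rw [mul_assoc]
  calc ‖(k • T) φ‖ = ‖k‖ * ‖T φ‖ := norm_smul k (T φ)
    _ ≤ _ := by gcongr; exact h φ

theorem HasDistributionIntegral.smul {E : Type*} [NormedAddCommGroup E]
    [InnerProductSpace ℝ E] {T : 𝓢'(E, ℂ)} {c : ℂ} (h : HasDistributionIntegral T c)
    (k : ℂ) : HasDistributionIntegral (k • T) (k * c) :=
  ⟨h.1.smul k, fun χ hχ ↦ (h.2 χ hχ).const_mul k⟩

/-- No growth hypothesis is needed: multiplication by a function not of temperate growth is `0` by
default, and a nonzero scalar does not affect temperate growth. -/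
theorem smulLeftCLM_const_smul {E : Type*} [NormedAddCommGroup E]
    [NormedSpace ℝ E] (a : ℂ) (g : E → ℂ) :
    SchwartzMap.smulLeftCLM ℂ (a • g) = a • SchwartzMap.smulLeftCLM ℂ g := by
  by_cases hg : g.HasTemperateGrowth
  · exact SchwartzMap.smulLeftCLM_smul hg a
  · rcases eq_or_ne a 0 with rfl | ha
    · rw [zero_smul, zero_smul]
      exact (SchwartzMap.smulLeftCLM_const (E := E) (F := ℂ) (0 : ℂ)).trans (zero_smul _ _)
    · have h : ¬ (a • g).HasTemperateGrowth := by
        intro h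
        apply hg
        have := (Function.HasTemperateGrowth.const (E := E) a⁻¹).mul h
        convert! this using 1
        funext x
        simp [ha]
      simp [SchwartzMap.smulLeftCLM, hg, h]

theorem IsSConvolution.smul_smul {E : Type*} [NormedAddCommGroup E]
    [InnerProductSpace ℝ E] {S T W : 𝓢'(E, ℂ)} (h : IsSConvolution S T W) (a b : ℂ) :
    IsSConvolution (a • S) (b • T) ((a * b) • W) := by
  intro φ
  have h1 : convReflect φ (a • S) = a • convReflect φ S := rfl
  have h2 : TemperedDistribution.smulLeftCLM ℂ (a • convReflect φ S) (b • T) =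
      (a * b) • TemperedDistribution.smulLeftCLM ℂ (convReflect φ S) T := by
    ext χ
    simp only [TemperedDistribution.smulLeftCLM_apply_apply]
    rw [smulLeftCLM_const_smul]
    simp [mul_assoc]
  rw [h1, h2]
  exact (h φ).smul (a * b)

variable {E : Type} [NormedAddCommGroup E] [InnerProductSpace ℝ E] [FiniteDimensional ℝ E]
  [MeasurableSpace E] [BorelSpace E]

theorem convReflect_toTemperedDistribution (μ : Measure E) [μ.HasTemperateGrowth]
    (φ : 𝓢(E, ℂ)) :
    convReflect φ μ.toTemperedDistribution = fun y ↦ ∫ w, φ (w + y) ∂μ := by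
  funext y
  simp [convReflect]

/-- By Fubini `φ ∗ μ⁻` is `ν`-integrable with integral `∫ φ dρ`. So `(φ ∗ μ⁻) ν` is a finite complex
measure: it is bounded by the sup norm alone, and approximate units are handled by dominated
convergence. -/
theorem isSConvolution_toTemperedDistribution {μ ν ρ : Measure E} [SFinite μ] [SFinite ν]
    [μ.HasTemperateGrowth] [ν.HasTemperateGrowth] [ρ.HasTemperateGrowth] (h : μ.conv ν = ρ) :
    IsSConvolution μ.toTemperedDistribution ν.toTemperedDistribution
      ρ.toTemperedDistribution := by
  intro φ
  rw [convReflect_toTemperedDistribution]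
  have hg := hasTemperateGrowth_integral_shift μ φ
  set g : E → ℂ := fun y ↦ ∫ w, φ (w + y) ∂μ with hgdef
  have happ : ∀ χ : 𝓢(E, ℂ), TemperedDistribution.smulLeftCLM ℂ g ν.toTemperedDistribution χ =
      ∫ y, g y * χ y ∂ν := by
    intro χ
    simp [SchwartzMap.smulLeftCLM_apply_apply hg]
  -- Integrability on the product is that of `φ` for `ρ`, since `ρ` is the image of `μ × ν` under
  -- addition.
  have hprod : Integrable (fun p : E × E ↦ φ (p.1 + p.2)) (μ.prod ν) := by
    have h1 := φ.integrable (μ := ρ)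
    rw [← h, Measure.conv] at h1
    exact h1.comp_measurable (by fun_prop)
  have hgi : Integrable g ν := hprod.integral_prod_right
  have hgρ : ∫ y, g y ∂ν = ∫ x, φ x ∂ρ := by
    rw [← h, Measure.conv, integral_map (by fun_prop) φ.continuous.aestronglyMeasurable,
      integral_prod_symm _ hprod]
  have hχ : ∀ χ : 𝓢(E, ℂ), ∀ y, ‖g y * χ y‖ ≤ SchwartzMap.seminorm ℂ 0 0 χ * ‖g y‖ := by
    intro χ y
    rw [norm_mul, mul_comm]
    gcongr
    exact SchwartzMap.norm_le_seminorm ℂ χ y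
  refine ⟨⟨0, ∫ y, ‖g y‖ ∂ν, fun χ ↦ ?_⟩, fun χ hχu ↦ ?_⟩
  · rw [happ]
    refine (norm_integral_le_of_norm_le (hgi.norm.const_mul _) (ae_of_all _ (hχ χ))).trans ?_
    rw [integral_const_mul, mul_comm]
    simp
  · obtain ⟨C, hC⟩ := hχu.bounded 0
    simp only [happ, Measure.toTemperedDistribution_apply]
    rw [← hgρ]
    refine tendsto_integral_of_dominated_convergence (fun y ↦ C * ‖g y‖)
      (fun n ↦ hgi.aestronglyMeasurable.mul (χ n).continuous.aestronglyMeasurable)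
      (hgi.norm.const_mul _) (fun n ↦ ae_of_all _ fun y ↦ ?_) (ae_of_all _ fun y ↦ ?_)
    · refine (hχ (χ n) y).trans ?_
      gcongr
      exact hC n
    · refine tendsto_const_nhds.congr' ?_
      filter_upwards [hχu.eventually_eq_one {y} isCompact_singleton] with n hn
      rw [hn y rfl, mul_one]

theorem IsFourierProduct.smul_smul {u v w : 𝓢'(E, ℂ)} (h : IsFourierProduct u v w) (a b : ℂ) :
    IsFourierProduct (a • u) (b • v) ((a * b) • w) := by
  unfold IsFourierProduct
  simp only [FourierTransform.fourier_smul]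
  exact IsSConvolution.smul_smul h a b

theorem IsFourierPower.smul {u w : 𝓢'(E, ℂ)} {n : ℕ} (h : IsFourierPower u n w) (c : ℂ) :
    IsFourierPower (c • u) n (c ^ n • w) := by
  induction h with
  | one => simpa using IsFourierPower.one
  | succ _ hp ih =>
    rw [pow_succ']
    exact ih.succ (hp.smul_smul _ _)

/-- Temperate growth is asked only from index `1` on, because in the application `M n` has parameter
`n * a`, which is positive only then. -/
theorem isFourierPower_fourierInv_toTemperedDistribution {M : ℕ → Measure E}
    [∀ n, SFinite (M n)] [∀ n, (M (n + 1)).HasTemperateGrowth]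
    (hM : ∀ n, (M 1).conv (M (n + 1)) = M (n + 2)) (n : ℕ) :
    IsFourierPower (𝓕⁻ (M 1).toTemperedDistribution) (n + 1)
      (𝓕⁻ (M (n + 1)).toTemperedDistribution) := by
  induction n with
  | zero => exact IsFourierPower.one
  | succ n ih =>
    refine ih.succ ?_
    unfold IsFourierProduct
    simp only [FourierTransform.fourier_fourierInv_eq]
    exact isSConvolution_toTemperedDistribution (hM n)

end MeasureConvolution

/-! ### Singular support of a distribution that is smooth off a closed set and blows up there -/

section SingularSupport

variable {E : Type*} [NormedAddCommGroup E] [InnerProductSpace ℝ E] [FiniteDimensional ℝ E]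
  [MeasurableSpace E] [BorelSpace E]

theorem eqOn_of_forall_integral_eq {Ω : Set E} (hΩ : IsOpen Ω) {g h : E → ℂ}
    (hg : ContinuousOn g Ω) (hh : ContinuousOn h Ω)
    (hgh : ∀ φ : 𝓢(E, ℂ), HasCompactSupport φ → tsupport φ ⊆ Ω →
      ∫ x, φ x * g x = ∫ x, φ x * h x) : Set.EqOn g h Ω := by
  have hint : ∀ k : E → ℂ, ContinuousOn k Ω → ∀ ψ : E → ℝ, Continuous ψ → HasCompactSupport ψ →
      tsupport ψ ⊆ Ω → Integrable (fun x ↦ (ψ x : ℂ) * k x) := by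
    intro k hk ψ hψ hψc hψs
    have hc : Continuous fun x ↦ (ψ x : ℂ) * k x := by
      refine continuous_of_tsupport fun x hx ↦ ?_
      have hx' : x ∈ tsupport ψ := by
        refine closure_mono ?_ hx
        intro y hy
        simp only [Function.mem_support] at hy ⊢
        intro h0
        simp [h0] at hy
      exact (Complex.continuous_ofReal.comp hψ).continuousAt.mul
        (hk.continuousAt (hΩ.mem_nhds (hψs hx')))
    refine hc.integrable_of_hasCompactSupport ?_
    exact (hψc.comp_left Complex.ofReal_zero).mul_right
  have hae : ∀ᵐ x ∂(volume : Measure E), x ∈ Ω → (g - h) x = 0 := by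
    refine hΩ.ae_eq_zero_of_integral_contDiff_smul_eq_zero
      ((hg.sub hh).locallyIntegrableOn hΩ.measurableSet) fun ψ hψ hψc hψs ↦ ?_
    have hψc' : HasCompactSupport fun x ↦ (ψ x : ℂ) := hψc.comp_left Complex.ofReal_zero
    have hψ' : ContDiff ℝ ∞ fun x ↦ (ψ x : ℂ) := Complex.ofRealCLM.contDiff.comp hψ
    have h1 := hgh (hψc'.toSchwartzMap hψ') hψc' ((closure_mono (by
      intro y hy
      simpa using hy)).trans hψs)
    change ∫ x, (ψ x : ℂ) * g x = ∫ x, (ψ x : ℂ) * h x at h1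
    simp only [Pi.sub_apply, Complex.real_smul, mul_sub]
    rw [integral_sub (hint g hg ψ hψ.continuous hψc hψs) (hint h hh ψ hψ.continuous hψc hψs),
      h1, sub_self]
  refine Measure.eqOn_open_of_ae_eq (μ := volume) ?_ hΩ hg hh
  rw [EventuallyEq, ae_restrict_iff' hΩ.measurableSet]
  filter_upwards [hae] with x hx hxΩ
  simpa [sub_eq_zero] using hx hxΩ

/-- A smooth representative `g` near `q ∉ Ω` would agree with `h` on the overlap with `Ω`, so `h`
would stay bounded along `l`. -/
theorem singSupp_eq_compl {f : 𝓢'(E, ℂ)} {Ω : Set E} (hΩ : IsOpen Ω) {h : E → ℂ}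
    (hh : ContDiffOn ℝ ∞ h Ω)
    (hf : ∀ φ : 𝓢(E, ℂ), HasCompactSupport φ → tsupport φ ⊆ Ω → f φ = ∫ x, φ x * h x)
    (hblow : ∀ q ∉ Ω, ∃ l : Filter E, l.NeBot ∧ l ≤ 𝓝 q ∧ Ω ∈ l ∧
      Tendsto (fun x ↦ ‖h x‖) l atTop) :
    singSupp f = Ωᶜ := by
  ext q
  simp only [singSupp, Set.mem_ofPred_eq, Set.mem_compl_iff, not_iff_not]
  constructor
  · rintro ⟨V, hV, hqV, g, hg, hfg⟩
    by_contra hq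
    obtain ⟨l, hl, hlq, hΩl, hlim⟩ := hblow q hq
    have heq : Set.EqOn g h (V ∩ Ω) := by
      refine eqOn_of_forall_integral_eq (hV.inter hΩ) (hg.continuousOn.mono Set.inter_subset_left)
        (hh.continuousOn.mono Set.inter_subset_right) fun φ hφ hφs ↦ ?_
      rw [← hfg φ hφ (hφs.trans Set.inter_subset_left),
        hf φ hφ (hφs.trans Set.inter_subset_right)]
    have hgc : Tendsto (fun x ↦ ‖g x‖) l (𝓝 ‖g q‖) :=
      ((hg.continuousOn.continuousAt (hV.mem_nhds hqV)).norm.tendsto).mono_left hlq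
    refine not_tendsto_nhds_of_tendsto_atTop hlim ‖g q‖ (hgc.congr' ?_)
    filter_upwards [hΩl, hlq (hV.mem_nhds hqV)] with x hx hxV
    rw [heq ⟨hxV, hx⟩]
  · exact fun hq ↦ ⟨Ω, hΩ, hq, h, hh, hf⟩

end SingularSupport

/-! ### The distribution `(x + i0)^(-a)` -/

section XPlusIZero

instance (a : ℝ) [ha : Fact (0 < a)] : (rieszMeasure a).HasTemperateGrowth :=
  hasTemperateGrowth_rieszMeasure ha.out

/-- The constant `(2π / i)^a`. -/
def fourierConst (a : ℝ) : ℂ := (2 * Real.pi / Complex.I) ^ (a : ℂ)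

/-- The distribution `(x + i0)^(-a)` on the line, for `a > 0`. -/
def xPlusIZeroNegPow (a : ℝ) [Fact (0 < a)] : 𝓢'(ℝ, ℂ) :=
  fourierConst a • 𝓕⁻ (rieszMeasure a).toTemperedDistribution

theorem xPlusIZeroNegPow_apply (a : ℝ) [Fact (0 < a)] (φ : 𝓢(ℝ, ℂ)) :
    xPlusIZeroNegPow a φ = fourierConst a * ∫ ξ, (𝓕⁻ φ) ξ ∂(rieszMeasure a) := by
  simp [xPlusIZeroNegPow]

theorem two_pi_div_I_eq : (2 * Real.pi / Complex.I : ℂ) = ((2 * Real.pi : ℝ) : ℂ) * (-Complex.I) := by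
  rw [div_eq_mul_inv, Complex.inv_I]
  push_cast
  rfl

theorem two_pi_div_I_ne_zero : (2 * Real.pi / Complex.I : ℂ) ≠ 0 := by
  have := Real.pi_ne_zero
  simp [this]

/-- Principal powers are multiplicative here: `2π/i` has argument `-π/2` and `w` has argument in
`[0, π]`, so the sum stays in the principal range. -/
theorem cpow_neg_eq_fourierConst_mul (a : ℝ) {w : ℂ} (hw : 0 < w.im) :
    w ^ (-(a : ℂ)) = fourierConst a * ((2 * Real.pi / Complex.I) * w) ^ (-(a : ℂ)) := by
  have hw0 : w ≠ 0 := by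
    rintro rfl
    simp at hw
  have harg : (2 * Real.pi / Complex.I : ℂ).arg = -(Real.pi / 2) := by
    rw [two_pi_div_I_eq, Complex.arg_real_mul _ (by positivity), Complex.arg_neg_I]
  have hlog := Complex.log_mul two_pi_div_I_ne_zero hw0 (by
    rw [harg]
    have h1 := Complex.arg_nonneg_iff.2 hw.le
    have h2 := Complex.arg_le_pi w
    have := Real.pi_pos
    constructor <;> linarith)
  rw [fourierConst, Complex.cpow_def_of_ne_zero (mul_ne_zero two_pi_div_I_ne_zero hw0),
    Complex.cpow_def_of_ne_zero two_pi_div_I_ne_zero, Complex.cpow_def_of_ne_zero hw0,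
    ← Complex.exp_add, hlog]
  ring_nf

/-- The Laplace formula at `z = (2π/i)(x + iε)`, whose real part is `2πε`, followed by Fubini; the
damping factor gives the joint integrability. -/
theorem integral_mul_cpow_eq {a : ℝ} (ha : 0 < a) (φ : 𝓢(ℝ, ℂ)) {ε : ℝ} (hε : 0 < ε) :
    ∫ x : ℝ, φ x * ((x : ℂ) + (ε : ℂ) * Complex.I) ^ (-(a : ℂ)) =
      fourierConst a * ∫ ξ, (Real.exp (-(2 * Real.pi * ε) * ξ) : ℂ) * (𝓕⁻ φ) ξ
        ∂(rieszMeasure a) := by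
  have hexp : ∀ x ξ : ℝ,
      Complex.exp (-((2 * Real.pi / Complex.I) * ((x : ℂ) + (ε : ℂ) * Complex.I)) * ξ) =
      (Real.exp (-(2 * Real.pi * ε) * ξ) : ℂ) *
        Complex.exp (((2 * Real.pi * inner ℝ x ξ : ℝ) : ℂ) * Complex.I) := by
    intro x ξ
    rw [Complex.ofReal_exp, ← Complex.exp_add, div_eq_mul_inv, Complex.inv_I]
    congr 1
    simp only [RCLike.inner_apply, conj_trivial]
    push_cast
    linear_combination (2 * Real.pi * ε * ξ) * Complex.I_mul_I
  have hint : Integrable (Function.uncurry fun x ξ : ℝ ↦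
      (Real.exp (-(2 * Real.pi * ε) * ξ) : ℂ) *
        (Complex.exp (((2 * Real.pi * inner ℝ x ξ : ℝ) : ℂ) * Complex.I) * φ x))
      (volume.prod (rieszMeasure a)) := by
    have h1 := (φ.integrable (μ := volume)).norm.mul_prod (integrable_exp_rieszMeasure ha
      (r := -(2 * Real.pi * ε)) (by have := Real.pi_pos; simp only [Left.neg_neg_iff]; positivity))
    refine h1.mono' ?_ (ae_of_all _ fun p ↦ ?_)
    · refine Continuous.aestronglyMeasurable ?_
      have := φ.continuous
      simp only [Function.uncurry_def]
      fun_prop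
    · simp only [Function.uncurry_def, norm_mul, Complex.norm_exp_ofReal_mul_I,
        Complex.norm_real, Real.norm_eq_abs, Real.abs_exp, one_mul]
      rw [mul_comm]
  have hz : ∀ x : ℝ, 0 < ((2 * Real.pi / Complex.I) * ((x : ℂ) + (ε : ℂ) * Complex.I)).re := by
    intro x
    have := Real.pi_pos
    rw [div_eq_mul_inv, Complex.inv_I]
    simp
    positivity
  calc ∫ x : ℝ, φ x * ((x : ℂ) + (ε : ℂ) * Complex.I) ^ (-(a : ℂ))
      = ∫ x : ℝ, fourierConst a * ∫ ξ, (Real.exp (-(2 * Real.pi * ε) * ξ) : ℂ) *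
        (Complex.exp (((2 * Real.pi * inner ℝ x ξ : ℝ) : ℂ) * Complex.I) * φ x)
          ∂(rieszMeasure a) := by
        congr 1 with x
        rw [cpow_neg_eq_fourierConst_mul a (by simpa using hε),
          ← integral_cexp_rieszMeasure ha (hz x), mul_left_comm, ← integral_const_mul]
        congr 2 with ξ
        rw [hexp]
        ring
    _ = fourierConst a * ∫ ξ, (∫ x : ℝ, (Real.exp (-(2 * Real.pi * ε) * ξ) : ℂ) *
        (Complex.exp (((2 * Real.pi * inner ℝ x ξ : ℝ) : ℂ) * Complex.I) * φ x))
          ∂(rieszMeasure a) := by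
        rw [integral_const_mul, integral_integral_swap hint]
    _ = _ := by
        congr 2 with ξ
        rw [integral_const_mul, SchwartzMap.fourierInv_coe, Real.fourierInv_eq']
        rfl

theorem isXPlusIZeroPow_xPlusIZeroNegPow (a : ℝ) [ha : Fact (0 < a)] :
    IsXPlusIZeroPow (-a) (xPlusIZeroNegPow a) := by
  intro φ
  rw [xPlusIZeroNegPow_apply]
  have key : Tendsto (fun ε : ℝ ↦ ∫ ξ, (Real.exp (-(2 * Real.pi * ε) * ξ) : ℂ) * (𝓕⁻ φ) ξ
      ∂(rieszMeasure a)) (𝓝[>] 0) (𝓝 (∫ ξ, (𝓕⁻ φ) ξ ∂(rieszMeasure a))) := by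
    -- On the Fourier side the limit is dominated for every `a > 0`, whereas `|x|^(-a)` need not be
    -- integrable at `0`.
    refine tendsto_integral_filter_of_dominated_convergence (fun ξ ↦ ‖(𝓕⁻ φ) ξ‖)
      (Eventually.of_forall fun ε ↦ ?_) ?_ ((𝓕⁻ φ).integrable).norm (ae_of_all _ fun ξ ↦ ?_)
    · refine Continuous.aestronglyMeasurable ?_
      have := (𝓕⁻ φ).continuous
      fun_prop
    · filter_upwards [self_mem_nhdsWithin] with ε (hε : 0 < ε)
      filter_upwards [ae_rieszMeasure_pos a] with ξ hξ
      rw [norm_mul, Complex.norm_real, Real.norm_eq_abs, Real.abs_exp]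
      refine mul_le_of_le_one_left (norm_nonneg _) (Real.exp_le_one_iff.2 ?_)
      have := Real.pi_pos
      have : 0 < 2 * Real.pi * ε * ξ := by positivity
      linarith
    · have hc : Continuous fun ε : ℝ ↦
          (Real.exp (-(2 * Real.pi * ε) * ξ) : ℂ) * (𝓕⁻ φ) ξ := by fun_prop
      have := (hc.tendsto 0).mono_left (nhdsWithin_le_nhds (s := Set.Ioi 0))
      simpa using this
  refine (key.const_mul (fourierConst a)).congr' ?_
  filter_upwards [self_mem_nhdsWithin] with ε (hε : 0 < ε)
  rw [← integral_mul_cpow_eq ha.out φ hε, Complex.ofReal_neg]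

theorem contDiffOn_ofReal_cpow (c : ℂ) : ContDiffOn ℝ ∞ (fun x : ℝ ↦ (x : ℂ) ^ c) {0}ᶜ := by
  have hpos : ∀ x : ℝ, 0 < x → ContDiffAt ℝ ∞ (fun x : ℝ ↦ (x : ℂ) ^ c) x := by
    intro x hx
    have h1 : ContDiffAt ℝ ∞ (fun y : ℝ ↦ Complex.exp ((Real.log y : ℂ) * c)) x :=
      ((Complex.ofRealCLM.contDiff.contDiffAt.comp x
        (Real.contDiffAt_log.2 hx.ne')).mul contDiffAt_const).cexp
    refine h1.congr_of_eventuallyEq ?_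
    filter_upwards [lt_mem_nhds hx] with y hy
    rw [Complex.cpow_def_of_ne_zero (by simpa using hy.ne'), Complex.ofReal_log hy.le]
  intro x hx
  refine ContDiffAt.contDiffWithinAt ?_
  rcases lt_or_gt_of_ne (show x ≠ 0 from hx) with h | h
  · have h1 : ContDiffAt ℝ ∞ (fun y : ℝ ↦ ((-y : ℝ) : ℂ) ^ c *
        Complex.exp (Real.pi * Complex.I * c)) x :=
      (ContDiffAt.comp x (hpos (-x) (by linarith)) contDiffAt_id.neg).mul contDiffAt_const
    refine h1.congr_of_eventuallyEq ?_
    filter_upwards [gt_mem_nhds h] with y hy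
    rw [Complex.ofReal_cpow_of_nonpos hy.le]
    simp
  · exact hpos x h

theorem tendsto_cpow_add_mul_I (c : ℂ) {x : ℝ} (hx : x ≠ 0) :
    Tendsto (fun ε : ℝ ↦ ((x : ℂ) + (ε : ℂ) * Complex.I) ^ c) (𝓝[>] 0) (𝓝 ((x : ℂ) ^ c)) := by
  have hx' : (x : ℂ) ≠ 0 := by simpa using hx
  have h0 : Tendsto (fun ε : ℝ ↦ (x : ℂ) + (ε : ℂ) * Complex.I) (𝓝[>] 0) (𝓝 (x : ℂ)) := by
    have hc : Continuous fun ε : ℝ ↦ (x : ℂ) + (ε : ℂ) * Complex.I := by fun_prop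
    have := (hc.tendsto 0).mono_left (nhdsWithin_le_nhds (s := Set.Ioi 0))
    simpa using this
  have hlog : Tendsto (fun ε : ℝ ↦ Complex.log ((x : ℂ) + (ε : ℂ) * Complex.I)) (𝓝[>] 0)
      (𝓝 (Complex.log x)) := by
    rcases lt_or_gt_of_ne hx with h | h
    -- On the negative axis the principal logarithm is continuous only from above, the side from
    -- which `x + iε` arrives.
    · refine (Complex.continuousWithinAt_log_of_re_neg_of_im_zero (by simpa using h)
        (by simp)).tendsto.comp (tendsto_nhdsWithin_iff.2 ⟨h0, ?_⟩)
      filter_upwards [self_mem_nhdsWithin] with ε (hε : 0 < ε)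
      simpa using hε.le
    · exact (continuousAt_clog (by simp [Complex.slitPlane, h])).tendsto.comp h0
  have h1 := (Complex.continuous_exp.tendsto _).comp (hlog.mul_const c)
  rw [Complex.cpow_def_of_ne_zero hx']
  refine h1.congr' ?_
  filter_upwards [h0.eventually_ne hx'] with ε hε
  rw [Complex.cpow_def_of_ne_zero hε]
  rfl

theorem xPlusIZeroNegPow_apply_of_tsupport_subset (a : ℝ) [ha : Fact (0 < a)] {φ : 𝓢(ℝ, ℂ)}
    (hφs : tsupport φ ⊆ {0}ᶜ) :
    xPlusIZeroNegPow a φ = ∫ x : ℝ, φ x * (x : ℂ) ^ (-(a : ℂ)) := by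
  have ha0 : 0 < a := ha.out
  refine tendsto_nhds_unique (isXPlusIZeroPow_xPlusIZeroNegPow a φ) ?_
  obtain ⟨δ, hδ, hball⟩ := Metric.isOpen_iff.1 (isClosed_tsupport φ).isOpen_compl 0
    (fun h ↦ hφs h rfl)
  have hfar : ∀ x, φ x ≠ 0 → δ ≤ |x| := by
    intro x hx
    by_contra! h
    exact hball (by simpa using h) (subset_tsupport φ hx)
  rw [Complex.ofReal_neg]
  refine tendsto_integral_filter_of_dominated_convergence (fun x ↦ ‖φ x‖ * δ ^ (-a))
    ?_ ?_ (φ.integrable.norm.mul_const _) (ae_of_all _ fun x ↦ ?_)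
  · filter_upwards [self_mem_nhdsWithin] with ε (hε : 0 < ε)
    refine (φ.continuous.mul ?_).aestronglyMeasurable
    refine continuous_iff_continuousAt.2 fun x ↦ ?_
    refine ContinuousAt.cpow (by fun_prop) continuousAt_const (Or.inr ?_)
    simpa using hε.ne'
  · filter_upwards [self_mem_nhdsWithin] with ε (hε : 0 < ε)
    refine ae_of_all _ fun x ↦ ?_
    rw [norm_mul, ← Complex.ofReal_neg, Complex.norm_cpow_real]
    by_cases hx : φ x = 0
    · simp [hx]
    · refine mul_le_mul_of_nonneg_left ?_ (norm_nonneg _)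
      refine Real.rpow_le_rpow_of_nonpos hδ ((hfar x hx).trans ?_) (neg_nonpos.2 ha0.le)
      simpa using Complex.abs_re_le_norm ((x : ℂ) + (ε : ℂ) * Complex.I)
  · by_cases hx : φ x = 0
    · simp [hx]
    · refine (tendsto_cpow_add_mul_I _ ?_).const_mul _
      rintro rfl
      simpa using hδ.trans_le (hfar 0 hx)

theorem tendsto_norm_cpow_atTop {a : ℝ} (ha : 0 < a) :
    Tendsto (fun x : ℝ ↦ ‖(x : ℂ) ^ (-(a : ℂ))‖) (𝓝[>] 0) atTop := by
  refine (tendsto_rpow_neg_nhdsGT_zero (y := -a) (by linarith)).congr' ?_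
  filter_upwards [self_mem_nhdsWithin] with x (hx : 0 < x)
  rw [← Complex.ofReal_neg, Complex.norm_cpow_real, Complex.norm_real, Real.norm_of_nonneg hx.le]

theorem singSupp_xPlusIZeroNegPow (a : ℝ) [ha : Fact (0 < a)] :
    singSupp (xPlusIZeroNegPow a) = {0} := by
  rw [singSupp_eq_compl isOpen_compl_singleton (contDiffOn_ofReal_cpow (-(a : ℂ)))
    (fun φ _ hφ ↦ xPlusIZeroNegPow_apply_of_tsupport_subset a hφ), compl_compl]
  intro q hq
  obtain rfl : q = 0 := by simpa using hq
  refine ⟨𝓝[>] 0, inferInstance, nhdsWithin_le_nhds, ?_, tendsto_norm_cpow_atTop ha.out⟩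
  filter_upwards [self_mem_nhdsWithin] with x (hx : 0 < x)
  exact hx.ne'

end XPlusIZero

/-! ### The stationary distribution on the plane -/

section Stationary

/-- The embedding `ξ ↦ (ξ, 0)` of the line into the plane. -/
def axisEmb : ℝ →L[ℝ] Plane := ContinuousLinearMap.toSpanSingleton ℝ (!₂[1, 0] : Plane)

theorem axisEmb_apply (ξ : ℝ) : axisEmb ξ = !₂[ξ, 0] := by
  ext i
  fin_cases i <;> simp [axisEmb]

theorem norm_axisEmb (ξ : ℝ) : ‖axisEmb ξ‖ = ‖ξ‖ := by
  simp [axisEmb_apply, EuclideanSpace.norm_eq, Real.sqrt_sq_eq_abs]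

/-- The measure `(ξ₊^(a-1) / Γ(a)) ⊗ δ₀` on the plane. -/
def planeMeasure (a : ℝ) : Measure Plane := (rieszMeasure a).map axisEmb

instance (a : ℝ) : SFinite (planeMeasure a) := by
  unfold planeMeasure
  infer_instance

instance (a : ℝ) [ha : Fact (0 < a)] : (planeMeasure a).HasTemperateGrowth := by
  obtain ⟨n, hn⟩ := (hasTemperateGrowth_rieszMeasure ha.out).exists_integrable
  refine ⟨n, ?_⟩
  rw [planeMeasure, integrable_map_measure
    (Measurable.aestronglyMeasurable (by fun_prop)) (by fun_prop)]
  simpa [Function.comp_def, norm_axisEmb] using hn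

theorem planeMeasure_conv {a b : ℝ} (ha : 0 < a) (hb : 0 < b) :
    (planeMeasure a).conv (planeMeasure b) = planeMeasure (a + b) := by
  rw [planeMeasure, planeMeasure, ← Measure.map_conv_continuousLinearMap,
    rieszMeasure_conv ha hb, planeMeasure]

/-- The stationary distribution `(x + i0)^(-a)` on the plane, for `a > 0`. -/
def stationaryNegPow (a : ℝ) [Fact (0 < a)] : 𝓢'(Plane, ℂ) :=
  fourierConst a • 𝓕⁻ (planeMeasure a).toTemperedDistribution

theorem stationaryNegPow_apply (a : ℝ) [Fact (0 < a)] (φ : 𝓢(Plane, ℂ)) :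
    stationaryNegPow a φ = fourierConst a * ∫ ξ, (𝓕⁻ φ) (axisEmb ξ) ∂(rieszMeasure a) := by
  simp only [stationaryNegPow, planeMeasure]
  change fourierConst a * ∫ q, (𝓕⁻ φ) q ∂(Measure.map axisEmb (rieszMeasure a)) = _
  rw [integral_map (by fun_prop) (𝓕⁻ φ).continuous.aestronglyMeasurable]

theorem slice_apply (t : ℝ) (φ : 𝓢(Plane, ℂ)) (x : ℝ) : slice t φ x = φ !₂[x, t] := by
  simp [slice]

theorem hasFDerivAt_slice (t x : ℝ) : HasFDerivAt (fun x : ℝ ↦ (!₂[x, t] : Plane)) axisEmb x := by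
  have h : (fun x : ℝ ↦ (!₂[x, t] : Plane)) = fun x : ℝ ↦ axisEmb x + !₂[0, t] := by
    funext x
    rw [axisEmb_apply]
    ext i
    fin_cases i <;> simp
  rw [h]
  exact axisEmb.hasFDerivAt.add_const _

theorem slice_lineDerivOp (t : ℝ) (φ : 𝓢(Plane, ℂ)) :
    slice t (∂_{(!₂[1, 0] : Plane)} φ) = ∂_{(1 : ℝ)} (slice t φ) := by
  ext x
  rw [slice_apply, SchwartzMap.lineDerivOp_apply_eq_fderiv,
    SchwartzMap.lineDerivOp_apply_eq_fderiv]
  have h1 : HasFDerivAt (slice t φ) ((fderiv ℝ φ !₂[x, t]).comp axisEmb) x := by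
    have h2 := (φ.hasFDerivAt !₂[x, t]).comp x (hasFDerivAt_slice t x)
    refine h2.congr_of_eventuallyEq (Eventually.of_forall fun y ↦ ?_)
    simp [slice_apply]
  rw [h1.fderiv, ContinuousLinearMap.comp_apply, axisEmb_apply]

theorem fourierInv_lineDerivOp_lineDerivOp {E : Type*} [NormedAddCommGroup E]
    [InnerProductSpace ℝ E] [FiniteDimensional ℝ E] [MeasurableSpace E] [BorelSpace E]
    (φ : 𝓢(E, ℂ)) (m ξ : E) :
    (𝓕⁻ (∂_{m} (∂_{m} φ))) ξ = -(((2 * Real.pi * inner ℝ ξ m) ^ 2 : ℝ) : ℂ) * (𝓕⁻ φ) ξ := by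
  have : (inner ℝ · m : E → ℝ).HasTemperateGrowth := by fun_prop
  simp only [SchwartzMap.fourierInv_lineDerivOp_eq, smul_apply,
    SchwartzMap.smulLeftCLM_apply_apply this, smul_eq_mul, Complex.real_smul]
  push_cast
  linear_combination (4 * Real.pi ^ 2 * (inner ℝ ξ m) ^ 2 * (𝓕⁻ φ) ξ : ℂ) * Complex.I_sq

theorem slice_sub (t : ℝ) (φ ψ : 𝓢(Plane, ℂ)) : slice t (φ - ψ) = slice t φ - slice t ψ := by
  simp [slice]

/-- Take `ψ = (1 - ∂ₓ²)^N φ`: each factor contributes `1 + (2πξ)²` after transforming in `x`. One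
`ψ` serves all `t`, which yields decay in `ξ` uniform in `t`. -/
theorem exists_fourierInv_slice_eq (φ : 𝓢(Plane, ℂ)) (N : ℕ) :
    ∃ ψ : 𝓢(Plane, ℂ), ∀ t ξ : ℝ,
      (𝓕⁻ (slice t φ)) ξ =
        ((((1 + (2 * Real.pi * ξ) ^ 2) ^ N)⁻¹ : ℝ) : ℂ) * (𝓕⁻ (slice t ψ)) ξ := by
  induction N with
  | zero => exact ⟨φ, fun t ξ ↦ by simp⟩
  | succ N ih =>
    obtain ⟨ψ, hψ⟩ := ih
    refine ⟨ψ - ∂_{(!₂[1, 0] : Plane)} (∂_{(!₂[1, 0] : Plane)} ψ), fun t ξ ↦ ?_⟩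
    have h0 : (1 + (2 * Real.pi * ξ) ^ 2 : ℂ) ≠ 0 := by
      have : (1 + (2 * Real.pi * ξ) ^ 2 : ℝ) ≠ 0 := by positivity
      exact_mod_cast this
    rw [hψ, slice_sub, slice_lineDerivOp, slice_lineDerivOp,
      show ∀ f g : 𝓢(ℝ, ℂ), 𝓕⁻ (f - g) = 𝓕⁻ f - 𝓕⁻ g from
        map_sub (FourierTransform.fourierInvCLM ℂ 𝓢(ℝ, ℂ)), sub_apply, fourierInv_lineDerivOp_lineDerivOp]
    simp only [RCLike.inner_apply, conj_trivial, one_mul]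
    push_cast
    have hF : ∀ F : ℂ, F - -(2 * Real.pi * ξ) ^ 2 * F = (1 + (2 * Real.pi * ξ) ^ 2 : ℂ) * F :=
      fun F ↦ by ring
    rw [hF, pow_succ _ N, mul_inv]
    generalize (1 + (2 * Real.pi * ξ) ^ 2 : ℂ) = A at h0 ⊢
    field_simp

end Stationary

/-! ### Coordinates on the plane, slices, and the stationary distribution off the axis -/

section Plane

/-- Coordinates `(t, x) ↦ (x, t)` on the plane. -/
def planeEquiv : ℝ × ℝ ≃ᵐ Plane :=
  (MeasurableEquiv.prodComm.trans MeasurableEquiv.finTwoArrow.symm).trans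
    (MeasurableEquiv.toLp 2 (Fin 2 → ℝ))

theorem planeEquiv_apply (p : ℝ × ℝ) : planeEquiv p = !₂[p.2, p.1] := by
  ext i
  fin_cases i <;> rfl

theorem measurePreserving_planeEquiv :
    MeasurePreserving planeEquiv (volume.prod volume) (volume : Measure Plane) :=
  (PiLp.volume_preserving_toLp (Fin 2)).comp
    (((volume_preserving_finTwoArrow ℝ).symm _).comp Measure.measurePreserving_swap)

theorem integrable_plane_iff {f : Plane → ℂ} :
    Integrable (fun p : ℝ × ℝ ↦ f !₂[p.2, p.1]) (volume.prod volume) ↔ Integrable f := by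
  rw [← measurePreserving_planeEquiv.integrable_comp_emb planeEquiv.measurableEmbedding]
  simp only [Function.comp_def, planeEquiv_apply]

theorem integral_plane {f : Plane → ℂ} (hf : Integrable f) :
    ∫ q, f q = ∫ t : ℝ, ∫ x : ℝ, f !₂[x, t] := by
  rw [← measurePreserving_planeEquiv.integral_comp planeEquiv.measurableEmbedding]
  simp only [planeEquiv_apply]
  exact integral_prod _ (integrable_plane_iff.2 hf)

theorem continuous_plane : Continuous fun p : ℝ × ℝ ↦ (!₂[p.1, p.2] : Plane) := by
  refine (PiLp.continuous_toLp 2 _).comp (continuous_pi fun i ↦ ?_)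
  fin_cases i
  · exact continuous_fst
  · exact continuous_snd

/-- The projection-slice theorem: the phase does not involve `t` when the frequency lies on the
axis. -/
theorem fourierInv_axisEmb (φ : 𝓢(Plane, ℂ)) (ξ : ℝ) :
    (𝓕⁻ φ) (axisEmb ξ) = ∫ t : ℝ, (𝓕⁻ (slice t φ)) ξ := by
  have hint : Integrable fun q : Plane ↦
      Complex.exp (((2 * Real.pi * inner ℝ q (axisEmb ξ) : ℝ) : ℂ) * Complex.I) • φ q := by
    refine φ.integrable.norm.mono' ?_ (ae_of_all _ fun q ↦ ?_)
    · have := φ.continuous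
      exact Continuous.aestronglyMeasurable (by fun_prop)
    · rw [norm_smul, Complex.norm_exp_ofReal_mul_I, one_mul]
  rw [SchwartzMap.fourierInv_coe, Real.fourierInv_eq', integral_plane hint]
  congr 1 with t
  rw [SchwartzMap.fourierInv_coe, Real.fourierInv_eq']
  congr 1 with x
  rw [slice_apply, axisEmb_apply]
  congr 4
  simp [PiLp.inner_apply]

theorem exists_norm_slice_le (ψ : 𝓢(Plane, ℂ)) :
    ∃ C : ℝ, ∀ t x : ℝ, ‖slice t ψ x‖ ≤ C * ((1 + ‖t‖) ^ (-2 : ℝ) * (1 + ‖x‖) ^ (-2 : ℝ)) := by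
  -- Order `4` splits as `2 + 2`, an integrable weight in each coordinate.
  obtain ⟨C, hC, h⟩ := exists_norm_le_one_add_norm_rpow ψ 4
  refine ⟨C, fun t x ↦ ?_⟩
  rw [slice_apply]
  refine (h _).trans ?_
  gcongr
  have h1 : ‖x‖ ≤ ‖(!₂[x, t] : Plane)‖ := by
    simpa using PiLp.norm_apply_le (!₂[x, t] : Plane) 0
  have h2 : ‖t‖ ≤ ‖(!₂[x, t] : Plane)‖ := by
    simpa using PiLp.norm_apply_le (!₂[x, t] : Plane) 1
  have h3 : (-((4 : ℕ) : ℝ)) = (-2) + (-2) := by norm_num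
  rw [h3, Real.rpow_add (by positivity)]
  gcongr ?_ * ?_
  · exact Real.rpow_le_rpow_of_nonpos (by positivity) (by linarith) (by norm_num)
  · exact Real.rpow_le_rpow_of_nonpos (by positivity) (by linarith) (by norm_num)

/-- This licenses exchanging the `t`- and `ξ`-integrals. With the factor `(1 + (2πξ)²)^(-n)`
extracted, the triple integrand in `(t, ξ, x)` is dominated by a product of integrable weights. -/
theorem integrable_fourierInv_slice {μ : Measure ℝ} [SFinite μ] [hμ : μ.HasTemperateGrowth]
    (φ : 𝓢(Plane, ℂ)) :
    Integrable (Function.uncurry fun t ξ : ℝ ↦ (𝓕⁻ (slice t φ)) ξ) (volume.prod μ) := by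
  obtain ⟨n, hn⟩ := hμ.exists_integrable
  obtain ⟨ψ, hψ⟩ := exists_fourierInv_slice_eq φ n
  obtain ⟨C, hC⟩ := exists_norm_slice_le ψ
  have hw : Integrable (fun ξ : ℝ ↦ ((1 + (2 * Real.pi * ξ) ^ 2) ^ n)⁻¹) μ := by
    refine (hn.const_mul (2 ^ n)).mono' (Measurable.aestronglyMeasurable (by fun_prop))
      (ae_of_all _ fun ξ ↦ ?_)
    have hpi := Real.pi_gt_three
    have hle : 1 + ‖ξ‖ ≤ 2 * (1 + (2 * Real.pi * ξ) ^ 2) := by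
      rw [mul_pow, ← sq_abs ξ, ← Real.norm_eq_abs]
      have : 1 * ‖ξ‖ ^ 2 ≤ (2 * Real.pi) ^ 2 * ‖ξ‖ ^ 2 := by
        gcongr
        nlinarith
      nlinarith [sq_nonneg (‖ξ‖ - 1)]
    rw [Real.norm_of_nonneg (by positivity), Real.rpow_neg (by positivity), Real.rpow_natCast,
      ← div_eq_mul_inv, le_div_iff₀ (by positivity), ← div_eq_inv_mul, div_le_iff₀ (by positivity),
      ← mul_pow]
    gcongr
  have h2 : Integrable (fun x : ℝ ↦ (1 + ‖x‖) ^ (-2 : ℝ)) := by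
    simpa using integrable_one_add_norm (E := ℝ) (μ := volume) (r := 2) (by simp)
  have hF : Integrable (Function.uncurry fun (p : ℝ × ℝ) (x : ℝ) ↦
      ((((1 + (2 * Real.pi * p.2) ^ 2) ^ n)⁻¹ : ℝ) : ℂ) *
        (Complex.exp (((2 * Real.pi * inner ℝ x p.2 : ℝ) : ℂ) * Complex.I) • slice p.1 ψ x))
      ((volume.prod μ).prod volume) := by
    refine (((h2.mul_prod hw).mul_prod h2).const_mul C).mono' ?_ (ae_of_all _ fun q ↦ ?_)
    · refine Continuous.aestronglyMeasurable ?_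
      simp only [Function.uncurry_def, slice_apply]
      have h4 : Continuous fun q : (ℝ × ℝ) × ℝ ↦ ψ !₂[q.2, q.1.1] :=
        ψ.continuous.comp (continuous_plane.comp (continuous_snd.prodMk (by fun_prop)))
      have h5 : Continuous fun q : (ℝ × ℝ) × ℝ ↦ ((1 + (2 * Real.pi * q.1.2) ^ 2) ^ n)⁻¹ :=
        Continuous.inv₀ (by fun_prop) fun q ↦ by positivity
      have h6 : Continuous fun q : (ℝ × ℝ) × ℝ ↦ inner ℝ q.2 q.1.2 := by fun_prop
      fun_prop
    · simp only [Function.uncurry_def, norm_mul, norm_smul, Complex.norm_exp_ofReal_mul_I, one_mul,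
        Complex.norm_real]
      rw [Real.norm_of_nonneg (by positivity)]
      calc _ ≤ ((1 + (2 * Real.pi * q.1.2) ^ 2) ^ n)⁻¹ *
            (C * ((1 + ‖q.1.1‖) ^ (-2 : ℝ) * (1 + ‖q.2‖) ^ (-2 : ℝ))) := by
            gcongr
            exact hC _ _
        _ = _ := by ring
  refine hF.integral_prod_left.congr (ae_of_all _ fun p ↦ ?_)
  simp only [Function.uncurry_def]
  rw [integral_const_mul, hψ, SchwartzMap.fourierInv_coe (slice p.1 ψ), Real.fourierInv_eq']

theorem stationaryNegPow_eq_integral_slice (a : ℝ) [Fact (0 < a)] (φ : 𝓢(Plane, ℂ)) :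
    Integrable (fun t : ℝ ↦ xPlusIZeroNegPow a (slice t φ)) ∧
      stationaryNegPow a φ = ∫ t : ℝ, xPlusIZeroNegPow a (slice t φ) := by
  have h := integrable_fourierInv_slice (μ := rieszMeasure a) φ
  simp only [xPlusIZeroNegPow_apply, stationaryNegPow_apply, fourierInv_axisEmb]
  refine ⟨h.integral_prod_left.const_mul _, ?_⟩
  rw [integral_const_mul, integral_integral_swap h]

theorem isGivenByFamily_smul {g : ℝ → 𝓢'(ℝ, ℂ)} {U : 𝓢'(Plane, ℂ)} (h : IsGivenByFamily g U)
    (c : ℂ) : IsGivenByFamily (fun t ↦ c • g t) (c • U) := by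
  intro φ hφ
  obtain ⟨h1, h2⟩ := h φ hφ
  refine ⟨h1.const_mul c, ?_⟩
  change c * U φ = ∫ t, c * g t (slice t φ)
  rw [h2, integral_const_mul]

theorem isStationary_stationaryNegPow (a : ℝ) [Fact (0 < a)] :
    IsStationary (xPlusIZeroNegPow a) (stationaryNegPow a) :=
  fun φ _ ↦ stationaryNegPow_eq_integral_slice a φ

theorem hasInitialData_of_isStationary {u₀ : 𝓢'(ℝ, ℂ)} {U : 𝓢'(Plane, ℂ)}
    (h : IsStationary u₀ U) : HasInitialData U u₀ 0 :=
  ⟨fun _ ↦ u₀, h, fun _ ↦ contDiff_const, rfl, fun _ ↦ hasDerivAt_const _ _⟩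

theorem stationaryNegPow_apply_of_tsupport_subset (a : ℝ) [Fact (0 < a)] {φ : 𝓢(Plane, ℂ)}
    (hφ : HasCompactSupport φ) (hφs : tsupport φ ⊆ timeAxisᶜ) :
    stationaryNegPow a φ = ∫ q : Plane, φ q * (q 0 : ℂ) ^ (-(a : ℂ)) := by
  have hint : Integrable fun q : Plane ↦ φ q * (q 0 : ℂ) ^ (-(a : ℂ)) := by
    refine Continuous.integrable_of_hasCompactSupport ?_ hφ.mul_right
    refine continuous_of_tsupport fun q hq ↦ φ.continuous.continuousAt.mul ?_
    have hq0 : q 0 ≠ 0 := hφs (closure_mono (Function.support_mul_subset_left _ _) hq)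
    have h1 : ContinuousAt (fun x : ℝ ↦ (x : ℂ) ^ (-(a : ℂ))) (q 0) :=
      (contDiffOn_ofReal_cpow _).continuousOn.continuousAt
        (isOpen_compl_singleton.mem_nhds hq0)
    exact ContinuousAt.comp (f := fun q : Plane ↦ q 0) h1 (by fun_prop)
  rw [(stationaryNegPow_eq_integral_slice a φ).2, integral_plane hint]
  congr 1 with t
  rw [xPlusIZeroNegPow_apply_of_tsupport_subset]
  · simp [slice_apply]
  · have h1 : Continuous fun x : ℝ ↦ (!₂[x, t] : Plane) :=
      continuous_plane.comp (continuous_id.prodMk continuous_const)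
    have h2 : (slice t φ : ℝ → ℂ) = φ ∘ fun x : ℝ ↦ (!₂[x, t] : Plane) := by
      funext x
      exact slice_apply t φ x
    rw [h2]
    intro x hx
    have := hφs (tsupport_comp_subset_preimage φ h1 hx)
    simpa [timeAxis] using this

theorem isClosed_timeAxis : IsClosed timeAxis :=
  isClosed_eq (by fun_prop) continuous_const

theorem singSupp_stationaryNegPow (a : ℝ) [ha : Fact (0 < a)] :
    singSupp (stationaryNegPow a) = timeAxis := by
  have hmaps : Set.MapsTo (fun q : Plane ↦ q 0) timeAxisᶜ {0}ᶜ := fun q hq ↦ hq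
  have hsmooth : ContDiff ℝ ∞ fun q : Plane ↦ q 0 :=
    (EuclideanSpace.proj (𝕜 := ℝ) (0 : Fin 2)).contDiff
  rw [singSupp_eq_compl isClosed_timeAxis.isOpen_compl
    ((contDiffOn_ofReal_cpow (-(a : ℂ))).comp hsmooth.contDiffOn hmaps)
    (fun φ hφ hφs ↦ stationaryNegPow_apply_of_tsupport_subset a hφ hφs), compl_compl]
  intro q hq
  have hq0 : q 0 = 0 := by simpa [timeAxis] using hq
  have hc : Continuous fun x : ℝ ↦ (!₂[x, q 1] : Plane) :=
    continuous_plane.comp (continuous_id.prodMk continuous_const)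
  -- Approach `q` horizontally from the right.
  refine ⟨map (fun x : ℝ ↦ (!₂[x, q 1] : Plane)) (𝓝[>] 0), inferInstance, ?_, ?_, ?_⟩
  · have h1 := (hc.tendsto 0).mono_left (nhdsWithin_le_nhds (s := Set.Ioi 0))
    have h2 : (!₂[0, q 1] : Plane) = q := by
      ext i
      fin_cases i <;> simp [hq0]
    rwa [h2] at h1
  · rw [mem_map]
    filter_upwards [self_mem_nhdsWithin] with x (hx : 0 < x)
    simpa [timeAxis] using hx.ne'
  · rw [tendsto_map'_iff]
    simpa [Function.comp_def] using tendsto_norm_cpow_atTop ha.out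

theorem isNoncharacteristic_timeAxis : IsNoncharacteristic timeAxis := by
  intro n hn h
  have h1 : n 1 = 0 := by
    have := h !₂[0, 1] (by simp [timeAxis])
    simpa [PiLp.inner_apply] using this
  have h0 : n 0 ≠ 0 := by
    intro h0
    apply hn
    ext i
    fin_cases i <;> simp [h0, h1]
  rw [h1]
  have := sq_pos_of_ne_zero h0
  intro h2
  linarith

end Plane

/-! ### The wave equation -/

section WaveEquation

instance (a : ℝ) [ha : Fact (0 < a)] : Fact (0 < a + 2) := ⟨by linarith [ha.out]⟩

theorem fourierConst_add_two (a : ℝ) :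
    fourierConst (a + 2) = -(2 * Real.pi) ^ 2 * fourierConst a := by
  unfold fourierConst
  have h2 : ((a + 2 : ℝ) : ℂ) = (a : ℂ) + (2 : ℕ) := by push_cast; rfl
  rw [h2, Complex.cpow_add _ _ two_pi_div_I_ne_zero, Complex.cpow_natCast, div_pow, Complex.I_sq]
  ring

theorem fourierConst_pow (a : ℝ) (p : ℕ) : fourierConst a ^ p = fourierConst (p * a) := by
  unfold fourierConst
  rw [← Complex.cpow_nat_mul]
  push_cast
  rfl

/-- The `p`-fold convolution has parameter `p * a = a + 2`, and the constants `(2π/i)^a` multiply in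
the same way. -/
theorem isFourierPower_stationaryNegPow (a : ℝ) [ha : Fact (0 < a)] {p : ℕ} (hp : 1 ≤ p)
    (hpa : p * a = a + 2) :
    IsFourierPower (stationaryNegPow a) p (stationaryNegPow (a + 2)) := by
  have ha0 : 0 < a := ha.out
  obtain ⟨n, rfl⟩ : ∃ n, p = n + 1 := ⟨p - 1, by omega⟩
  have hpos : ∀ n : ℕ, 0 < ((n + 1 : ℕ) : ℝ) * a := fun n ↦ by positivity
  have hfact : ∀ n : ℕ, Fact (0 < ((n + 1 : ℕ) : ℝ) * a) := fun n ↦ ⟨hpos n⟩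
  have h := isFourierPower_fourierInv_toTemperedDistribution
    (M := fun n ↦ planeMeasure ((n : ℝ) * a)) (fun n ↦ by
      have h1 : 0 < ((1 : ℕ) : ℝ) * a := by simpa using ha0
      rw [planeMeasure_conv h1 (hpos n)]
      congr 1
      push_cast
      ring) n
  simp only [hpa, Nat.cast_one, one_mul] at h
  have h' := h.smul (fourierConst a)
  have hc : fourierConst a ^ (n + 1) = fourierConst (a + 2) := by rw [fourierConst_pow, hpa]
  rwa [hc] at h'

theorem lineDerivOp_lineDerivOp_stationaryNegPow (a : ℝ) [Fact (0 < a)] (m : Plane)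
    (φ : 𝓢(Plane, ℂ)) :
    (∂_{m} (∂_{m} (stationaryNegPow a))) φ = fourierConst a *
      ∫ ξ, -(((2 * Real.pi * inner ℝ (axisEmb ξ) m) ^ 2 : ℝ) : ℂ) * (𝓕⁻ φ) (axisEmb ξ)
        ∂(rieszMeasure a) := by
  have h1 : (∂_{m} (∂_{m} (stationaryNegPow a))) φ = stationaryNegPow a (∂_{m} (∂_{m} φ)) := by
    have h2 : ∂_{m} (-∂_{m} φ) = -∂_{m} (∂_{m} φ) := map_neg (LineDeriv.lineDerivOpCLM ℂ 𝓢(Plane, ℂ) m) _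
    rw [TemperedDistribution.lineDerivOp_apply_apply, TemperedDistribution.lineDerivOp_apply_apply,
      h2, neg_neg]
  rw [h1, stationaryNegPow_apply]
  simp only [fourierInv_lineDerivOp_lineDerivOp]

/-- The transform is carried by the `ξ`-axis, which is orthogonal to the time direction, so the
multiplier vanishes there. -/
theorem lineDerivOp_time_stationaryNegPow (a : ℝ) [Fact (0 < a)] :
    ∂_{(!₂[0, 1] : Plane)} (∂_{(!₂[0, 1] : Plane)} (stationaryNegPow a)) = 0 := by
  ext φ
  rw [lineDerivOp_lineDerivOp_stationaryNegPow]
  simp [axisEmb_apply, PiLp.inner_apply]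

/-- The multiplier `-(2πξ)²` supplies `a(a+1)` through the shift of the Riesz parameter, and `-(2π)²
= (2π/i)²` turns the constant for `a` into that for `a + 2`. -/
theorem lineDerivOp_space_stationaryNegPow (a : ℝ) [ha : Fact (0 < a)] :
    ∂_{(!₂[1, 0] : Plane)} (∂_{(!₂[1, 0] : Plane)} (stationaryNegPow a)) =
      ((a : ℂ) * (a + 1)) • stationaryNegPow (a + 2) := by
  ext φ
  have h1 : ∀ ξ : ℝ, -(((2 * Real.pi * inner ℝ (axisEmb ξ) (!₂[1, 0] : Plane)) ^ 2 : ℝ) : ℂ) *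
      (𝓕⁻ φ) (axisEmb ξ) =
      (-(2 * Real.pi) ^ 2 : ℂ) * (ξ ^ 2 • (𝓕⁻ φ) (axisEmb ξ)) := by
    intro ξ
    simp only [axisEmb_apply, PiLp.inner_apply, Fin.sum_univ_two, RCLike.inner_apply,
      Complex.real_smul]
    simp
    ring
  rw [lineDerivOp_lineDerivOp_stationaryNegPow]
  simp only [h1]
  rw [integral_const_mul, integral_sq_smul_rieszMeasure ha.out]
  change _ = ((a : ℂ) * (a + 1)) * stationaryNegPow (a + 2) φ
  rw [stationaryNegPow_apply, fourierConst_add_two, Complex.real_smul]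
  push_cast
  ring

theorem isDistributionalSolution_smul_stationaryNegPow (a : ℝ) [ha : Fact (0 < a)] {p : ℕ}
    (hp : 1 ≤ p) (hpa : p * a = a + 2) {k c : ℂ} (hk : k * c ^ p = -(c * ((a : ℂ) * (a + 1)))) :
    IsDistributionalSolution k p (c • xPlusIZeroNegPow a) 0 (c • stationaryNegPow a) := by
  refine ⟨⟨c ^ p • stationaryNegPow (a + 2),
    (isFourierPower_stationaryNegPow a hp hpa).smul c, ?_⟩, ?_⟩
  · have hs : ∀ (m : Plane) (f : 𝓢'(Plane, ℂ)), ∂_{m} (c • f) = c • ∂_{m} f :=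
      fun m ↦ map_smul (LineDeriv.lineDerivOpCLM ℂ 𝓢'(Plane, ℂ) m) c
    have h0 : c • (0 : 𝓢'(Plane, ℂ)) = 0 := by
      ext φ
      exact mul_zero c
    rw [hs, hs, hs, hs, lineDerivOp_time_stationaryNegPow, lineDerivOp_space_stationaryNegPow,
      smul_smul, smul_smul, h0, zero_sub, hk, neg_smul]
  · exact hasInitialData_of_isStationary
      (isGivenByFamily_smul (isStationary_stationaryNegPow a) c)

end WaveEquation

/-! ### Local Sobolev regularity -/

section Sobolev

theorem rpow_le_rpow_abs_mul_rpow {x y K : ℝ} (b : ℝ) (hx : 0 < x) (hy : 0 < y)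
    (hxy : x ≤ K * y) (hyx : y ≤ K * x) : x ^ b ≤ K ^ |b| * y ^ b := by
  have hK : 0 < K := pos_of_mul_pos_left (hx.trans_le hxy) hy.le
  rcases le_total 0 b with hb | hb
  · rw [abs_of_nonneg hb, ← Real.mul_rpow hK.le hy.le]
    exact Real.rpow_le_rpow hx.le hxy hb
  · rw [abs_of_nonpos hb, Real.rpow_neg hK.le, ← Real.inv_rpow hK.le,
      ← Real.mul_rpow (inv_nonneg.2 hK.le) hy.le]
    refine Real.rpow_le_rpow_of_nonpos (by positivity) ?_ hb
    rwa [inv_mul_le_iff₀ hK]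

theorem one_add_sub_sq_le (u v : ℝ) : 1 + (u - v) ^ 2 ≤ 2 * (1 + u ^ 2) * (1 + v ^ 2) := by
  nlinarith [sq_nonneg (u + v), sq_nonneg (u * v), sq_nonneg u, sq_nonneg v]

/-- A Peetre-type inequality moves the weight from `η` to `y` at the price of a power of `1 + (η +
y)²`. The indicator term absorbs the possible singularity at `η = 0`. -/
theorem rpow_le_mul_one_add_sq_rpow {a y : ℝ} {η : ℝ} (hη : 0 < η) :
    η ^ (a - 1) ≤ 2 ^ |(a - 1) / 2| *
      ((2 * (1 + (η + y) ^ 2)) ^ |(a - 1) / 2| * (1 + y ^ 2) ^ ((a - 1) / 2)) *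
      (1 + (Set.Ioc 0 1).indicator (fun η : ℝ ↦ η ^ (a - 1)) η) := by
  set b := (a - 1) / 2 with hb
  have hJ : (1 + η ^ 2) ^ b ≤ (2 * (1 + (η + y) ^ 2)) ^ |b| * (1 + y ^ 2) ^ b := by
    refine rpow_le_rpow_abs_mul_rpow b (by positivity) (by positivity) ?_ ?_
    · simpa using one_add_sub_sq_le (η + y) y
    · simpa using one_add_sub_sq_le (η + y) η
  have h0 : 0 ≤ η ^ (a - 1) := by positivity
  have hmain : η ^ (a - 1) ≤ 2 ^ |b| * (1 + η ^ 2) ^ b *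
      (1 + (Set.Ioc 0 1).indicator (fun η : ℝ ↦ η ^ (a - 1)) η) := by
    by_cases h : η ∈ Set.Ioc (0 : ℝ) 1
    · have h1 : (1 : ℝ) ^ b ≤ 2 ^ |b| * (1 + η ^ 2) ^ b := by
        refine rpow_le_rpow_abs_mul_rpow b one_pos (by positivity) ?_ ?_ <;> nlinarith [h.1, h.2]
      rw [Real.one_rpow] at h1
      rw [Set.indicator_of_mem h]
      nlinarith
    · have h1 : 1 < η := by
        by_contra! h'
        exact h ⟨hη, h'⟩
      rw [Set.indicator_of_notMem h, add_zero, mul_one]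
      have h2 : η ^ (a - 1) = (η ^ 2) ^ b := by
        rw [← Real.rpow_natCast, ← Real.rpow_mul hη.le, hb]
        congr 1
        push_cast
        ring
      rw [h2]
      refine rpow_le_rpow_abs_mul_rpow b (by positivity) (by positivity) ?_ ?_ <;> nlinarith
  refine hmain.trans ?_
  have h3 : 0 ≤ (Set.Ioc 0 1).indicator (fun η : ℝ ↦ η ^ (a - 1)) η :=
    Set.indicator_nonneg (fun x hx ↦ Real.rpow_nonneg hx.1.le _) η
  gcongr

theorem exists_norm_mul_one_add_sq_rpow_le (κ : 𝓢(ℝ, ℂ)) {b : ℝ} (hb : 0 ≤ b) :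
    ∃ M : ℝ, 0 ≤ M ∧ ∀ x, ‖κ x‖ * (2 * (1 + x ^ 2)) ^ b ≤ M * (1 + ‖x‖) ^ (-2 : ℝ) := by
  obtain ⟨k, hk⟩ := exists_nat_ge (2 * b + 2)
  obtain ⟨C, hC, h⟩ := exists_norm_le_one_add_norm_rpow κ k
  refine ⟨C * 2 ^ b, by positivity, fun x ↦ ?_⟩
  have h1 : (1 + x ^ 2) ^ b ≤ (1 + ‖x‖) ^ (2 * b) := by
    rw [Real.rpow_mul (by positivity)]
    refine Real.rpow_le_rpow (by positivity) ?_ hb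
    rw [← sq_abs x, ← Real.norm_eq_abs]
    norm_cast
    nlinarith [norm_nonneg x]
  rw [Real.mul_rpow (by norm_num) (by positivity)]
  calc ‖κ x‖ * (2 ^ b * (1 + x ^ 2) ^ b)
      ≤ (C * (1 + ‖x‖) ^ (-(k : ℝ))) * (2 ^ b * (1 + ‖x‖) ^ (2 * b)) := by
        gcongr
        exact h x
    _ = C * 2 ^ b * (1 + ‖x‖) ^ (-(k : ℝ) + 2 * b) := by
        rw [Real.rpow_add (by positivity)]
        ring
    _ ≤ C * 2 ^ b * (1 + ‖x‖) ^ (-2 : ℝ) := by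
        gcongr
        · simp
        · linarith

/-- Smoothing by a Schwartz function preserves the growth rate of the density and removes its
singularity: the decay of `κ` pays for the Peetre factor. -/
theorem exists_norm_integral_shift_rieszMeasure_le {a : ℝ} (ha : 0 < a) (κ : 𝓢(ℝ, ℂ)) :
    ∃ C : ℝ, ∀ y : ℝ, ‖∫ η, κ (η + y) ∂(rieszMeasure a)‖ ≤ C * (1 + y ^ 2) ^ ((a - 1) / 2) := by
  set b := (a - 1) / 2 with hb
  obtain ⟨M, hM, hκ⟩ := exists_norm_mul_one_add_sq_rpow_le κ (abs_nonneg b)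
  have hG := Real.Gamma_pos_of_pos ha
  have hI : Integrable (fun x : ℝ ↦ (1 + ‖x‖) ^ (-2 : ℝ)) := by
    simpa using integrable_one_add_norm (E := ℝ) (μ := volume) (r := 2) (by simp)
  have hind : Integrable ((Set.Ioc 0 1).indicator (fun η : ℝ ↦ η ^ (a - 1))) := by
    rw [integrable_indicator_iff measurableSet_Ioc,
      ← intervalIntegrable_iff_integrableOn_Ioc_of_le zero_le_one]
    exact intervalIntegral.intervalIntegrable_rpow' (by linarith)
  set ι : ℝ → ℝ := (Set.Ioc 0 1).indicator (fun η : ℝ ↦ η ^ (a - 1)) with hι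
  have hι0 : ∀ η, 0 ≤ ι η := fun η ↦
    Set.indicator_nonneg (fun x hx ↦ Real.rpow_nonneg hx.1.le _) η
  refine ⟨(Real.Gamma a)⁻¹ * (2 ^ |b| * M * ((∫ x : ℝ, (1 + ‖x‖) ^ (-2 : ℝ)) + ∫ x, ι x)),
    fun y ↦ ?_⟩
  have hIy : Integrable (fun η : ℝ ↦ (1 + ‖η + y‖) ^ (-2 : ℝ)) := hI.comp_add_right y
  have hbound : ∀ η : ℝ, 0 < η → ‖η ^ (a - 1) • κ (η + y)‖ ≤
      2 ^ |b| * (1 + y ^ 2) ^ b * M * ((1 + ‖η + y‖) ^ (-2 : ℝ) + ι η) := by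
    intro η hη
    have h1 : (1 + ‖η + y‖) ^ (-2 : ℝ) ≤ 1 :=
      Real.rpow_le_one_of_one_le_of_nonpos (by simp) (by norm_num)
    rw [norm_smul, Real.norm_of_nonneg (by positivity)]
    calc η ^ (a - 1) * ‖κ (η + y)‖
        ≤ (2 ^ |b| * ((2 * (1 + (η + y) ^ 2)) ^ |b| * (1 + y ^ 2) ^ b) * (1 + ι η)) *
          ‖κ (η + y)‖ := by
          gcongr
          exact rpow_le_mul_one_add_sq_rpow hη
      _ = 2 ^ |b| * (1 + y ^ 2) ^ b *
          (‖κ (η + y)‖ * (2 * (1 + (η + y) ^ 2)) ^ |b|) * (1 + ι η) := by ring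
      _ ≤ 2 ^ |b| * (1 + y ^ 2) ^ b * (M * (1 + ‖η + y‖) ^ (-2 : ℝ)) * (1 + ι η) := by
          have := hι0 η
          exact mul_le_mul_of_nonneg_right (mul_le_mul_of_nonneg_left (hκ _) (by positivity))
            (by positivity)
      _ = 2 ^ |b| * (1 + y ^ 2) ^ b * M * ((1 + ‖η + y‖) ^ (-2 : ℝ) +
          (1 + ‖η + y‖) ^ (-2 : ℝ) * ι η) := by ring
      _ ≤ _ := by
          gcongr
          exact mul_le_of_le_one_left (hι0 η) h1
  have hbi : Integrable fun η : ℝ ↦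
      2 ^ |b| * (1 + y ^ 2) ^ b * M * ((1 + ‖η + y‖) ^ (-2 : ℝ) + ι η) :=
    (hIy.add hind).const_mul _
  rw [integral_rieszMeasure ha, norm_smul, norm_inv, Real.norm_of_nonneg hG.le, mul_assoc]
  gcongr
  calc ‖∫ η in Set.Ioi 0, η ^ (a - 1) • κ (η + y)‖
      ≤ ∫ η in Set.Ioi 0,
        2 ^ |b| * (1 + y ^ 2) ^ b * M * ((1 + ‖η + y‖) ^ (-2 : ℝ) + ι η) := by
        refine norm_integral_le_of_norm_le hbi.integrableOn ?_
        filter_upwards [ae_restrict_mem measurableSet_Ioi] with η hη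
        exact hbound η hη
    _ ≤ ∫ η, 2 ^ |b| * (1 + y ^ 2) ^ b * M * ((1 + ‖η + y‖) ^ (-2 : ℝ) + ι η) := by
        refine setIntegral_le_integral hbi (ae_of_all _ fun η ↦ ?_)
        have := hι0 η
        simp only [Pi.zero_apply]
        positivity
    _ = _ := by
        rw [integral_const_mul, integral_add hIy hind,
          integral_add_right_eq_self (fun η : ℝ ↦ (1 + ‖η‖) ^ (-2 : ℝ)) y]
        ring

/-- The squared bound decays like `|ξ|^(-2(1-s-a))`, and `2(1-s-a) > 1` is the hypothesis on `s`. -/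
theorem memLp_two_of_norm_le {s a C : ℝ} (hs : s < 1 / 2 - a) {G : ℝ → ℂ} (hG : Continuous G)
    (h : ∀ ξ, ‖G ξ‖ ≤ C * (1 + ξ ^ 2) ^ ((s + a - 1) / 2)) : MemLp G 2 := by
  rw [memLp_two_iff_integrable_sq_norm hG.aestronglyMeasurable]
  have h1 : Integrable (fun ξ : ℝ ↦ (1 + ‖ξ‖ ^ 2) ^ (-(2 * (1 - s - a)) / 2)) :=
    integrable_rpow_neg_one_add_norm_sq (by simp; linarith)
  refine (h1.const_mul (C ^ 2)).mono' (hG.norm.pow 2).aestronglyMeasurable (ae_of_all _ fun ξ ↦ ?_)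
  rw [Real.norm_of_nonneg (by positivity)]
  calc ‖G ξ‖ ^ 2 ≤ (C * (1 + ξ ^ 2) ^ ((s + a - 1) / 2)) ^ 2 := by
        gcongr
        exact h ξ
    _ = _ := by
        rw [mul_pow, ← Real.rpow_natCast (_ ^ ((s + a - 1) / 2)), ← Real.rpow_mul (by positivity),
          Real.norm_eq_abs, sq_abs]
        congr 2
        push_cast
        ring

/-- The convolution theorem in weak form: it exhibits the transform of `Ψ 𝓕⁻μ` as the function `ξ ↦
∫ (𝓕⁻Ψ)(η - ξ) dμ(η)`. -/
theorem integral_fourierInv_smulLeftCLM_fourier {μ : Measure ℝ} [SFinite μ]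
    [hμ : μ.HasTemperateGrowth] (Ψ θ : 𝓢(ℝ, ℂ)) :
    ∫ η, (𝓕⁻ (SchwartzMap.smulLeftCLM ℂ Ψ (𝓕 θ))) η ∂μ =
      ∫ ξ, θ ξ * ∫ η, (𝓕⁻ Ψ) (η + -ξ) ∂μ := by
  have hconv : ∀ η, (𝓕⁻ (SchwartzMap.smulLeftCLM ℂ Ψ (𝓕 θ))) η =
      ∫ ξ, θ ξ * (𝓕⁻ Ψ) (η + -ξ) := by
    intro η
    have h1 : 𝓕⁻ (SchwartzMap.smulLeftCLM ℂ Ψ (𝓕 θ)) =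
        SchwartzMap.convolution (ContinuousLinearMap.mul ℂ ℂ) θ (𝓕⁻ Ψ) := by
      have h2 : 𝓕 (SchwartzMap.convolution (ContinuousLinearMap.mul ℂ ℂ) θ (𝓕⁻ Ψ)) =
          SchwartzMap.smulLeftCLM ℂ Ψ (𝓕 θ) := by
        rw [SchwartzMap.fourier_convolution, FourierTransform.fourier_fourierInv_eq]
        ext x
        simp [SchwartzMap.smulLeftCLM_apply_apply Ψ.hasTemperateGrowth, mul_comm]
      rw [← h2, FourierTransform.fourierInv_fourier_eq]
    rw [h1, SchwartzMap.convolution_apply]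
    simp [convolution, sub_eq_add_neg]
  obtain ⟨C, hC, hκ⟩ := exists_norm_le_one_add_norm_rpow (𝓕⁻ Ψ) μ.integrablePower
  have hint : Integrable (Function.uncurry fun η ξ : ℝ ↦ θ ξ * (𝓕⁻ Ψ) (η + -ξ))
      (μ.prod volume) := by
    have hθ : Integrable fun ξ : ℝ ↦ C * ((1 + ‖ξ‖) ^ μ.integrablePower * ‖θ ξ‖) := by
      obtain ⟨D, hD, hθ⟩ := exists_norm_le_one_add_norm_rpow θ (μ.integrablePower + 2)
      have hI : Integrable (fun x : ℝ ↦ (1 + ‖x‖) ^ (-2 : ℝ)) := by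
        simpa using integrable_one_add_norm (E := ℝ) (μ := volume) (r := 2) (by simp)
      refine Integrable.const_mul ?_ C
      have hc := θ.continuous
      refine (hI.const_mul D).mono' (Continuous.aestronglyMeasurable (by fun_prop))
        (ae_of_all _ fun ξ ↦ ?_)
      rw [Real.norm_of_nonneg (by positivity)]
      calc (1 + ‖ξ‖) ^ μ.integrablePower * ‖θ ξ‖
          ≤ (1 + ‖ξ‖) ^ μ.integrablePower *
            (D * (1 + ‖ξ‖) ^ (-((μ.integrablePower + 2 : ℕ) : ℝ))) := by
            gcongr
            exact hθ ξ
        _ = _ := by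
            rw [mul_left_comm, ← Real.rpow_natCast, ← Real.rpow_add (by positivity)]
            congr 2
            push_cast
            ring
    refine (μ.integrable_pow_neg_integrablePower.mul_prod hθ).mono' ?_ (ae_of_all _ fun p ↦ ?_)
    · have h1 := θ.continuous
      have h2 := (𝓕⁻ Ψ).continuous
      simp only [Function.uncurry_def]
      exact Continuous.aestronglyMeasurable (by fun_prop)
    · simp only [Function.uncurry_def, norm_mul]
      calc ‖θ p.2‖ * ‖(𝓕⁻ Ψ) (p.1 + -p.2)‖
          ≤ ‖θ p.2‖ * (C * ((1 + ‖p.2‖) ^ μ.integrablePower *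
            (1 + ‖p.1‖) ^ (-(μ.integrablePower : ℝ)))) := by
            gcongr
            refine (hκ _).trans ?_
            gcongr
            exact one_add_norm_add_rpow_le _ _ (by simp) _
        _ = _ := by ring
  simp only [hconv]
  rw [integral_integral_swap hint]
  congr 1 with ξ
  rw [integral_const_mul]

theorem memSobolevLoc_xPlusIZeroNegPow (a : ℝ) [ha : Fact (0 < a)] {s : ℝ} (hs : s < 1 / 2 - a) :
    MemSobolevLoc s (xPlusIZeroNegPow a) := by
  intro ψ hψ hψc
  set Ψ : 𝓢(ℝ, ℂ) := hψc.toSchwartzMap hψ with hΨ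
  obtain ⟨C, hC⟩ := exists_norm_integral_shift_rieszMeasure_le ha.out (𝓕⁻ Ψ)
  have hJ' : (fun x : ℝ ↦ (((1 + ‖x‖ ^ 2) ^ (s / 2) : ℝ) : ℂ)).HasTemperateGrowth := by fun_prop
  set G : ℝ → ℂ := fun ξ ↦ fourierConst a * ((((1 + ‖ξ‖ ^ 2) ^ (s / 2) : ℝ) : ℂ) *
    ∫ η, (𝓕⁻ Ψ) (η + -ξ) ∂(rieszMeasure a)) with hGdef
  have hGc : Continuous G := by
    have h1 := (hasTemperateGrowth_integral_shift (rieszMeasure a) (𝓕⁻ Ψ)).1.continuous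
    have h2 : Continuous fun ξ : ℝ ↦ ∫ η, (𝓕⁻ Ψ) (η + -ξ) ∂(rieszMeasure a) :=
      h1.comp continuous_neg
    exact continuous_const.mul (hJ'.1.continuous.mul h2)
  have hGL : MemLp G 2 := by
    refine memLp_two_of_norm_le (C := ‖fourierConst a‖ * C) hs hGc fun ξ ↦ ?_
    rw [hGdef]
    simp only [norm_mul, Complex.norm_real, mul_assoc]
    refine mul_le_mul_of_nonneg_left ?_ (norm_nonneg _)
    rw [Real.norm_of_nonneg (by positivity), Real.norm_eq_abs, sq_abs,
      show (s + a - 1) / 2 = s / 2 + (a - 1) / 2 by ring, Real.rpow_add (by positivity),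
      mul_left_comm]
    refine mul_le_mul_of_nonneg_left ?_ (by positivity)
    simpa using hC (-ξ)
  rw [TemperedDistribution.memSobolev_iff_exists_smulLeftCLM_fourier]
  refine ⟨hGL.toLp G, ?_⟩
  ext θ
  rw [Lp.toTemperedDistribution_apply,
    integral_congr_ae (g := fun ξ ↦ θ ξ • G ξ) (hGL.coeFn_toLp.mono fun ξ hξ ↦ by
      simp only [hξ])]
  rw [TemperedDistribution.smulLeftCLM_apply_apply, TemperedDistribution.fourier_apply,
    TemperedDistribution.smulLeftCLM_apply_apply, xPlusIZeroNegPow_apply]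
  have hΨψ : ψ = Ψ := rfl
  rw [hΨψ, integral_fourierInv_smulLeftCLM_fourier, ← integral_const_mul]
  congr 1 with ξ
  rw [SchwartzMap.smulLeftCLM_apply_apply hJ', hGdef]
  simp only [smul_eq_mul]
  ring

end Sobolev

/-! ### Amplitudes for prescribed coefficients, and the main theorem -/

theorem isDistributionalSolution_stationaryNegPow (a : ℝ) [Fact (0 < a)] {p : ℕ} (hp : 1 ≤ p)
    (hpa : p * a = a + 2) :
    IsDistributionalSolution (-(((-a : ℝ) : ℂ) * (((-a : ℝ) : ℂ) - 1))) p (xPlusIZeroNegPow a) 0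
      (stationaryNegPow a) := by
  have h := isDistributionalSolution_smul_stationaryNegPow a hp hpa (c := 1)
    (k := -(((-a : ℝ) : ℂ) * (((-a : ℝ) : ℂ) - 1))) (by push_cast; ring)
  rwa [one_smul, one_smul] at h

theorem exists_isDistributionalSolution_smul (a : ℝ) [ha : Fact (0 < a)] {p : ℕ} (hp : 2 ≤ p)
    (hpa : p * a = a + 2) {k : ℂ} (hk : k ≠ 0) :
    ∃ c : ℂ, c ≠ 0 ∧
      IsDistributionalSolution k p (c • xPlusIZeroNegPow a) 0 (c • stationaryNegPow a) := by
  have ha0 : 0 < a := ha.out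
  obtain ⟨n, rfl⟩ : ∃ n, p = n + 1 := ⟨p - 1, by omega⟩
  have hn : n ≠ 0 := by omega
  -- One factor `c` cancels from `k c^p = -c a(a+1)`, leaving a root of order `p - 1 ≥ 1` to
  -- extract.
  obtain ⟨c, hc⟩ := IsAlgClosed.exists_pow_nat_eq (-((a : ℂ) * (a + 1)) / k)
    (Nat.pos_of_ne_zero hn)
  have ha1 : (a : ℂ) * (a + 1) ≠ 0 := by
    have : a * (a + 1) ≠ 0 := by positivity
    exact_mod_cast this
  refine ⟨c, ?_, isDistributionalSolution_smul_stationaryNegPow a (by omega) hpa ?_⟩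
  · rintro rfl
    rw [zero_pow hn] at hc
    exact div_ne_zero (neg_ne_zero.2 ha1) hk hc.symm
  · rw [pow_succ, hc]
    field_simp

end NLW

end

theorem proposition4p1 :
    (∀ s : ℝ, s < 1 / 2 →
      ∃ (p : ℕ) (lam : ℝ) (u₀ : 𝓢'(ℝ, ℂ)) (U : 𝓢'(NLW.Plane, ℂ)),
        2 ≤ p ∧ lam = 2 / (1 - (p : ℝ)) ∧ lam < 0 ∧
        NLW.IsXPlusIZeroPow lam u₀ ∧
        NLW.MemSobolevLoc s u₀ ∧
        NLW.singSupp u₀ = {0} ∧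
        NLW.IsStationary u₀ U ∧
        NLW.IsDistributionalSolution (-((lam : ℂ) * ((lam : ℂ) - 1))) p u₀ 0 U ∧
        NLW.singSupp U = NLW.timeAxis ∧
        NLW.IsNoncharacteristic NLW.timeAxis) ∧
    (∀ p : ℕ, 2 ≤ p →
      ∃ (lam : ℝ) (u₀ : 𝓢'(ℝ, ℂ)) (U : 𝓢'(NLW.Plane, ℂ)),
        lam = 2 / (1 - (p : ℝ)) ∧ lam < 0 ∧
        NLW.IsXPlusIZeroPow lam u₀ ∧
        (∀ s : ℝ, s < 1 / 2 - 2 / ((p : ℝ) - 1) → NLW.MemSobolevLoc s u₀) ∧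
        NLW.singSupp u₀ = {0} ∧
        NLW.IsStationary u₀ U ∧
        NLW.IsDistributionalSolution (-((lam : ℂ) * ((lam : ℂ) - 1))) p u₀ 0 U ∧
        (∀ a : ℂ, a = 1 ∨ a = -1 →
          ∃ c : ℂ, c ≠ 0 ∧ NLW.IsDistributionalSolution a p (c • u₀) 0 (c • U)) ∧
        NLW.singSupp U = NLW.timeAxis) := by
  have hlam : ∀ p : ℕ, 2 ≤ p → -(2 / ((p : ℝ) - 1)) = 2 / (1 - (p : ℝ)) := by
    intro p _
    rw [← div_neg, neg_sub]
  have hpos : ∀ p : ℕ, 2 ≤ p → 0 < 2 / ((p : ℝ) - 1) := by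
    intro p hp
    have : (2 : ℝ) ≤ p := by exact_mod_cast hp
    exact div_pos two_pos (by linarith)
  have hpa : ∀ p : ℕ, 2 ≤ p → p * (2 / ((p : ℝ) - 1)) = 2 / ((p : ℝ) - 1) + 2 := by
    intro p hp
    have : (2 : ℝ) ≤ p := by exact_mod_cast hp
    have : (p : ℝ) - 1 ≠ 0 := by linarith
    field_simp
    ring
  constructor
  · intro s hs
    -- With `p = n + 2` the exponent is `a = 2 / (n + 1)`, which this choice makes smaller than `1/2
    -- - s`.
    obtain ⟨n, hn⟩ := exists_nat_gt (2 / (1 / 2 - s))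
    have hs' : 0 < 1 / 2 - s := by linarith
    have hp : 2 ≤ n + 2 := by omega
    have hsa : s < 1 / 2 - 2 / (((n + 2 : ℕ) : ℝ) - 1) := by
      have h1 : 2 / (((n + 2 : ℕ) : ℝ) - 1) < 1 / 2 - s := by
        rw [div_lt_comm₀ (by push_cast; linarith [n.cast_nonneg (α := ℝ)]) hs']
        push_cast
        linarith
      linarith
    have : Fact (0 < 2 / (((n + 2 : ℕ) : ℝ) - 1)) := ⟨hpos _ hp⟩
    exact ⟨n + 2, _, NLW.xPlusIZeroNegPow (2 / (((n + 2 : ℕ) : ℝ) - 1)),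
      NLW.stationaryNegPow (2 / (((n + 2 : ℕ) : ℝ) - 1)), hp, hlam _ hp, neg_lt_zero.2 (hpos _ hp),
      NLW.isXPlusIZeroPow_xPlusIZeroNegPow _, NLW.memSobolevLoc_xPlusIZeroNegPow _ hsa,
      NLW.singSupp_xPlusIZeroNegPow _, NLW.isStationary_stationaryNegPow _,
      NLW.isDistributionalSolution_stationaryNegPow _ (by omega) (hpa _ hp),
      NLW.singSupp_stationaryNegPow _, NLW.isNoncharacteristic_timeAxis⟩
  · intro p hp
    have : Fact (0 < 2 / ((p : ℝ) - 1)) := ⟨hpos _ hp⟩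
    refine ⟨_, NLW.xPlusIZeroNegPow (2 / ((p : ℝ) - 1)),
      NLW.stationaryNegPow (2 / ((p : ℝ) - 1)), hlam _ hp, neg_lt_zero.2 (hpos _ hp),
      NLW.isXPlusIZeroPow_xPlusIZeroNegPow _,
      fun s hs ↦ NLW.memSobolevLoc_xPlusIZeroNegPow _ hs,
      NLW.singSupp_xPlusIZeroNegPow _, NLW.isStationary_stationaryNegPow _,
      NLW.isDistributionalSolution_stationaryNegPow _ (by omega) (hpa _ hp), fun k hk ↦ ?_,
      NLW.singSupp_stationaryNegPow _⟩
    refine NLW.exists_isDistributionalSolution_smul _ hp (hpa _ hp) ?_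
    rcases hk with rfl | rfl <;> simp
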